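/- Let $n>2k\ge 10$ be integers and $[n]=\{1,\dots,n\}$. Call a family of sets intersecting if any two of its members have a common element. For $i\in\{1,3\}$ put $I_i=\{i+1,\dots,i+k\}$, and let $$\mathcal J_3=\{I_1,I_3\}\cup\Big\{F\in\binom{[n]}{k}: 1\in F,\ F\cap I_1\ne\emptyset,\ F\cap I_3\ne\emptyset\Big\}.$$ For $x\in[n]$ and a family $\mathcal G$ write $\mathcal G(\bar x)=\{G\in\mathcal G: x\notin G\}$. For $0\le l\le n-k$ let $\mathcal E_l$ denote the (unique up to a permutation of $[n]$) family $\mathcal E\subset\binom{[n]}{k}$ that, for some $x\in[n]$, is inclusion-maximal among the intersecting families $\mathcal G\subset\binom{[n]}{k}$ with $|\mathcal G(\bar x)|=l$ and, if $l\ge 2$, $\big|\bigcap_{G\in\mathcal G(\bar x)}G\big|=k-1$. (Thus $\mathcal E_0$ is a full star, and $\mathcal E_1$ is a Hilton--Milner family.) If $\mathcal F\subset\binom{[n]}{k}$ is an intersecting family with $|\mathcal F|>|\mathcal J_3|$, then there is $l\in\{0,1,\dots,k-1,n-k\}$ such that $\mathcal F$ is contained in a family isomorphic to $\mathcal E_l$,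 that is, in an image of $\mathcal E_l$ under a permutation of $[n]$. -/

import Mathlib

namespace LargeIntersecting

/-- The ground set `[n] = {1, …, n}`. -/
def ground (n : ℕ) : Finset ℕ := Finset.Icc 1 n

/-- `F` is an intersecting family of `k`-element subsets of `[n]`. -/
def IsIntersectingFamily (n k : ℕ) (F : Finset (Finset ℕ)) : Prop :=
  F ⊆ (ground n).powersetCard k ∧ ∀ A ∈ F, ∀ B ∈ F, (A ∩ B).Nonempty

/-- `I_i = [i + 1, k + i]`. -/
def interval (k i : ℕ) : Finset ℕ := Finset.Icc (i + 1) (k + i)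

/-- `J_i`: the two sets `I_1`, `I_i`, together with all `k`-subsets of `[n]` that contain `1`
and meet both `I_1` and `I_i`. -/
def familyJ (n k i : ℕ) : Finset (Finset ℕ) :=
  {interval k 1, interval k i} ∪
    ((ground n).powersetCard k).filter fun F =>
      1 ∈ F ∧ (F ∩ interval k 1).Nonempty ∧ (F ∩ interval k i).Nonempty

/-- The members of `F` that do not contain `x`. -/
def avoiding (x : ℕ) (F : Finset (Finset ℕ)) : Finset (Finset ℕ) :=
  F.filter fun A => x ∉ A

/-- The elements of `[n]` that lie in every member of `M`. -/
def commonIntersection (n : ℕ) (M : Finset (Finset ℕ)) : Finset ℕ :=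
  (ground n).filter fun j => ∀ A ∈ M, j ∈ A

/-- `E` is a copy of `E_l` in which `x` plays the role of the element `1`: it is inclusion-maximal
among the intersecting families of `k`-subsets of `[n]` with exactly `l` members avoiding `x`,
these members having common intersection of size `k - 1`.  For `l ≤ 1` there are no two members
avoiding `x` and the condition on their intersection is void, so that `E_0` is a full star and
`E_1` is a Hilton–Milner family. -/
def IsCopyOfE (n k l x : ℕ) (E : Finset (Finset ℕ)) : Prop :=
  Maximal (fun G : Finset (Finset ℕ) =>
    IsIntersectingFamily n k G ∧ (avoiding x G).card = l ∧
      (2 ≤ l → (commonIntersection n (avoiding x G)).card = k - 1)) E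

end LargeIntersecting

/-!
Let `ℬ` consist of the members of `F` that avoid `x`. A member that contains `x` is `{x} ∪ X`
where `X` meets every set in `ℬ`, so `#F` is at most `(n - 1).choose (k - 1) + #ℬ` minus the number
of `(k - 1)`-subsets of `[n] \ {x}` that are disjoint from some set in `ℬ`, the blocked sets.
Deciding for one element after the other whether it lies in the sets of `ℬ` or in the blocked sets
splits `#ℬ` minus the number of blocked sets into a sum over branches. Double counting or the
Kruskal–Katona theorem shows that most branches contribute at most `0`; on the remaining ones
enough members of `ℬ` are known for an explicit count. Unless some `k - 1` elements lie in all
members of `ℬ`, this yields `#F ≤ #J_3` as soon as `#ℬ ≤ (n - 3).choose (k - 2)`.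

Shifting removes the last restriction. A shifted `F` contains `[2, k + 2] \ {j}` for
`j = k, k + 1, k + 2`, and the ballot condition takes over the role of the Kruskal–Katona theorem.
If replacing `j` by `i` creates, for some `x`, a set of `k - 1` elements common to all members that
avoid `x`, then only few members of `F` avoid both `i` and `j`, and the two cross-intersecting
families of members with exactly one of `i` and `j` are compared directly.

Finally, suppose that a `(k - 1)`-set `S` lies in all members that avoid `x`. If there are at least
`k` of these, then every member of `F` meets `S`, so all `k`-sets that contain `S` and avoid `x` can
be added, which embeds `F` in a copy of `E_{n-k}`.
-/

namespace LargeIntersecting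

open Finset
open scoped FinsetFamily

section Slices

variable {α : Type*} [DecidableEq α] {A U V W Y : Finset α} {𝒢 : Finset (Finset α)} {p : ℕ}

/-- The subfamily of the members of `𝒢` that contain `U` and are disjoint from `W`. -/
def slice (U W : Finset α) (𝒢 : Finset (Finset α)) : Finset (Finset α) :=
  {A ∈ 𝒢 | U ⊆ A ∧ Disjoint A W}

theorem mem_slice : A ∈ slice U W 𝒢 ↔ A ∈ 𝒢 ∧ U ⊆ A ∧ Disjoint A W := by
  simp [slice]

theorem slice_subset : slice U W 𝒢 ⊆ 𝒢 :=
  filter_subset _ _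

theorem slice_empty_empty : slice ∅ ∅ 𝒢 = 𝒢 := by
  simp [slice]

theorem card_slice_insert_add_card_slice_insert (U W : Finset α) (𝒢 : Finset (Finset α)) (i : α) :
    #(slice (insert i U) W 𝒢) + #(slice U (insert i W) 𝒢) = #(slice U W 𝒢) := by
  rw [← card_filter_add_card_filter_not (s := slice U W 𝒢) (i ∈ ·)]
  congr 2 <;> ext A <;>
    simp only [mem_filter, mem_slice, insert_subset_iff, disjoint_insert_right] <;> tauto

/-- The link of `U` in the members of `𝒢` that are disjoint from `W`: the slice with `U` removed
from each member. -/
def link (U W : Finset α) (𝒢 : Finset (Finset α)) : Finset (Finset α) :=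
  (slice U W 𝒢).image (· \ U)

theorem mem_link :
    Y ∈ link U W 𝒢 ↔ Disjoint U Y ∧ Disjoint (U ∪ Y) W ∧ U ∪ Y ∈ 𝒢 := by
  simp only [link, mem_image, mem_slice]
  constructor
  · rintro ⟨A, ⟨hA, hUA, hAW⟩, rfl⟩
    rw [union_sdiff_of_subset hUA]
    exact ⟨disjoint_sdiff, hAW, hA⟩
  · rintro ⟨hUY, hW, h⟩
    exact ⟨U ∪ Y, ⟨h, subset_union_left, hW⟩, by rw [union_sdiff_cancel_left hUY]⟩

theorem card_link (U W : Finset α) (𝒢 : Finset (Finset α)) : #(link U W 𝒢) = #(slice U W 𝒢) := by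
  refine card_image_of_injOn fun A hA B hB h => ?_
  rw [← union_sdiff_of_subset (mem_slice.1 hA).2.1, ← union_sdiff_of_subset (mem_slice.1 hB).2.1]
  exact congrArg (U ∪ ·) h

theorem link_powersetCard (hU : U ⊆ V) (hUW : Disjoint U W) (hp : #U ≤ p) :
    link U W (V.powersetCard p) = (V \ (U ∪ W)).powersetCard (p - #U) := by
  ext Y
  simp only [mem_link, mem_powersetCard, union_subset_iff, disjoint_union_left, subset_sdiff,
    disjoint_union_right]
  constructor
  · rintro ⟨hUY, ⟨-, hYW⟩, ⟨-, hYV⟩, hc⟩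
    rw [card_union_of_disjoint hUY] at hc
    exact ⟨⟨hYV, hUY.symm, hYW⟩, by omega⟩
  · rintro ⟨⟨hYV, hYU, hYW⟩, hc⟩
    refine ⟨hYU.symm, ⟨hUW, hYW⟩, ⟨hU, hYV⟩, ?_⟩
    rw [card_union_of_disjoint hYU.symm]
    omega

theorem link_subset_powersetCard (h𝒢 : 𝒢 ⊆ V.powersetCard p) :
    link U W 𝒢 ⊆ (V \ (U ∪ W)).powersetCard (p - #U) := by
  intro Y hY
  obtain ⟨hUY, hW, h⟩ := mem_link.1 hY
  obtain ⟨hV, hc⟩ := mem_powersetCard.1 (h𝒢 h)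
  rw [card_union_of_disjoint hUY] at hc
  simp only [mem_powersetCard, subset_sdiff, disjoint_union_right]
  exact ⟨⟨subset_union_right.trans hV, hUY.symm, disjoint_of_subset_left subset_union_right hW⟩,
    by omega⟩

theorem card_sdiff_union (hU : U ⊆ V) (hW : W ⊆ V) (hUW : Disjoint U W) :
    #(V \ (U ∪ W)) = #V - #U - #W := by
  rw [card_sdiff_of_subset (union_subset hU hW), card_union_of_disjoint hUW, Nat.sub_sub]

theorem card_slice_powersetCard (hU : U ⊆ V) (hW : W ⊆ V) (hUW : Disjoint U W) (hp : #U ≤ p) :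
    #(slice U W (V.powersetCard p)) = (#V - #U - #W).choose (p - #U) := by
  rw [← card_link, link_powersetCard hU hUW hp, card_powersetCard, card_sdiff_union hU hW hUW]

theorem card_slice_univ_powersetCard [Fintype α] (hp : #U ≤ p) :
    #(slice U ∅ (univ.powersetCard p)) = (Fintype.card α - #U).choose (p - #U) := by
  simp [card_slice_powersetCard (subset_univ U) (empty_subset _) (disjoint_empty_right U) hp]

end Slices

section Blocked

variable {α : Type*} [DecidableEq α] {U V W X : Finset α} {ℬ : Finset (Finset α)} {p q : ℕ}

/-- The `p`-subsets of `V` that are disjoint from some member of `ℬ`, that is, those that cannot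
belong to a family which cross-intersects `ℬ`. -/
def blocked (V : Finset α) (p : ℕ) (ℬ : Finset (Finset α)) : Finset (Finset α) :=
  {X ∈ V.powersetCard p | ∃ B ∈ ℬ, Disjoint X B}

theorem mem_blocked : X ∈ blocked V p ℬ ↔ (X ⊆ V ∧ #X = p) ∧ ∃ B ∈ ℬ, Disjoint X B := by
  simp [blocked]

theorem blocked_subset_powersetCard : blocked V p ℬ ⊆ V.powersetCard p :=
  filter_subset _ _

theorem blocked_link_subset (hU : U ⊆ V) (hUW : Disjoint U W) (hp : #U ≤ p) :
    blocked (V \ (U ∪ W)) (p - #U) (link W U ℬ) ⊆ link U W (blocked V p ℬ) := by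
  intro X hX
  simp only [mem_blocked, subset_sdiff, disjoint_union_right] at hX
  obtain ⟨⟨⟨hXV, hXU, hXW⟩, hc⟩, B, hB, hXB⟩ := hX
  obtain ⟨-, hBU, hB⟩ := mem_link.1 hB
  rw [mem_link, mem_blocked, union_subset_iff, card_union_of_disjoint hXU.symm,
    disjoint_union_left]
  refine ⟨hXU.symm, ⟨hUW, hXW⟩, ⟨⟨hU, hXV⟩, by omega⟩, W ∪ B, hB, ?_⟩
  rw [disjoint_union_left]
  exact ⟨hBU.symm, disjoint_union_right.2 ⟨hXW, hXB⟩⟩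

/-- The number of members of `ℬ` that contain `W` and avoid `U`, minus the number of blocked
`p`-sets that contain `U` and avoid `W`.  Two such sets can only be disjoint if no element is in
both `U` and `W`, so `U` and `W` record the decisions made along a branch when one decides for one
element after the other on which side it lies. -/
def excess (V : Finset α) (p : ℕ) (ℬ : Finset (Finset α)) (U W : Finset α) : ℤ :=
  #(slice W U ℬ) - #(slice U W (blocked V p ℬ))

theorem excess_empty_empty : excess V p ℬ ∅ ∅ = #ℬ - #(blocked V p ℬ) := by
  simp only [excess, slice_empty_empty]

theorem excess_insert_add_excess_insert (V : Finset α) (p : ℕ) (ℬ : Finset (Finset α))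
    (U W : Finset α) (i : α) :
    excess V p ℬ (insert i U) W + excess V p ℬ U (insert i W) = excess V p ℬ U W := by
  unfold excess
  rw [← card_slice_insert_add_card_slice_insert W U ℬ i,
    ← card_slice_insert_add_card_slice_insert U W (blocked V p ℬ) i]
  push_cast
  ring

theorem excess_le_excess_of_subset {W T : Finset α} (hWT : W ⊆ T)
    (h : ∀ i ∈ T, ∀ W', W ⊆ W' → W' ⊆ T → i ∉ W' → excess V p ℬ (insert i U) W' ≤ 0) :
    excess V p ℬ U W ≤ excess V p ℬ U T := by
  obtain rfl | hne := eq_or_ne W T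
  · rfl
  obtain ⟨i, hiT, hiW⟩ := exists_of_ssubset (hWT.ssubset_of_ne hne)
  have ih := excess_le_excess_of_subset (insert_subset hiT hWT) fun j hj W' hW =>
    h j hj W' ((subset_insert i W).trans hW)
  have hi := h i hiT W Subset.rfl hWT hiW
  linarith [excess_insert_add_excess_insert V p ℬ U W i]
termination_by #(T \ W)
decreasing_by
  rw [sdiff_insert]
  exact card_erase_lt_of_mem (mem_sdiff.2 ⟨hiT, hiW⟩)

theorem excess_nonpos_of_forall_not_disjoint (h : ∀ B ∈ ℬ, W ⊆ B → ¬Disjoint B U) :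
    excess V p ℬ U W ≤ 0 := by
  have hempty : slice W U ℬ = ∅ :=
    filter_eq_empty_iff.2 fun B hB hWU => h B hB hWU.1 hWU.2
  simp [excess, hempty]

theorem excess_nonpos_of_not_disjoint (h : ¬Disjoint U W) : excess V p ℬ U W ≤ 0 :=
  excess_nonpos_of_forall_not_disjoint fun _ _ hW hU =>
    h (disjoint_of_subset_left hW hU).symm

theorem slice_eq_empty_of_card_lt (hℬ : ℬ ⊆ V.powersetCard q) (h : q < #W) : slice W U ℬ = ∅ := by
  refine filter_eq_empty_iff.2 fun B hB hWU => ?_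
  have := card_le_card hWU.1
  rw [(mem_powersetCard.1 (hℬ hB)).2] at this
  omega

theorem excess_nonpos_of_card_lt (hℬ : ℬ ⊆ V.powersetCard q) (h : q < #W) :
    excess V p ℬ U W ≤ 0 := by
  simp [excess, slice_eq_empty_of_card_lt hℬ h]

theorem excess_le_of_slice_subset_blocked (hU : U ⊆ V) (hW : W ⊆ V) (hUW : Disjoint U W)
    (hp : #U ≤ p) (h : slice U W (V.powersetCard p) ⊆ blocked V p ℬ) :
    excess V p ℬ U W ≤ #(slice W U ℬ) - ((#V - #U - #W).choose (p - #U) : ℕ) := by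
  unfold excess
  rw [← card_slice_powersetCard hU hW hUW hp]
  gcongr
  exact fun X hX => mem_slice.2 ⟨h hX, (mem_slice.1 hX).2⟩

theorem excess_le_of_exists_subset (hU : U ⊆ V) (hW : W ⊆ V) (hUW : Disjoint U W) (hp : #U ≤ p)
    (h : ∃ B ∈ ℬ, B ⊆ W) :
    excess V p ℬ U W ≤ #(slice W U ℬ) - ((#V - #U - #W).choose (p - #U) : ℕ) := by
  obtain ⟨B, hB, hBW⟩ := h
  refine excess_le_of_slice_subset_blocked hU hW hUW hp fun X hX => ?_
  obtain ⟨hXV, -, hXW⟩ := mem_slice.1 hX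
  exact mem_blocked.2 ⟨mem_powersetCard.1 hXV, B, hB, disjoint_of_subset_right hBW hXW⟩

theorem card_slice_le_one (hℬ : ℬ ⊆ V.powersetCard q) (hW : q ≤ #W) : #(slice W U ℬ) ≤ 1 := by
  have eq_of_mem : ∀ B ∈ slice W U ℬ, W = B := fun B hB =>
    have ⟨hB, hWB, _⟩ := mem_slice.1 hB
    eq_of_subset_of_card_le hWB ((mem_powersetCard.1 (hℬ hB)).2.trans_le hW)
  exact card_le_one.2 fun B hB C hC => (eq_of_mem B hB).symm.trans (eq_of_mem C hC)

theorem card_le_card_blocked_of_le (hℬ : ℬ ⊆ V.powersetCard q) (hqp : q ≤ p) (hpq : p + q ≤ #V) :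
    #ℬ ≤ #(blocked V p ℬ) := by
  have hdouble := card_mul_le_card_mul (s := ℬ) (t := blocked V p ℬ) (fun B X => Disjoint X B)
    (m := (#V - q).choose p) (n := (#V - p).choose q) ?_ ?_
  · have hle : (#V - p).choose q ≤ (#V - q).choose p := by
      obtain ⟨g, hg⟩ := Nat.exists_eq_add_of_le hpq
      rw [show #V - p = q + g by omega, show #V - q = p + g by omega, Nat.choose_symm_add,
        Nat.choose_symm_add]
      exact Nat.choose_le_choose g (by omega)
    have hpos : 0 < (#V - q).choose p := Nat.choose_pos (by omega)
    exact Nat.le_of_mul_le_mul_right (hdouble.trans (Nat.mul_le_mul_left _ hle)) hpos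
  · intro B hB
    obtain ⟨hBV, hBc⟩ := mem_powersetCard.1 (hℬ hB)
    rw [← hBc, ← card_sdiff_of_subset hBV, ← card_powersetCard]
    refine card_le_card fun X hX => ?_
    simp only [mem_powersetCard, subset_sdiff] at hX
    exact (mem_bipartiteAbove _).2 ⟨mem_blocked.2 ⟨⟨hX.1.1, hX.2⟩, B, hB, hX.1.2⟩, hX.1.2⟩
  · intro X hX
    obtain ⟨⟨hXV, hXc⟩, -⟩ := mem_blocked.1 hX
    rw [← hXc, ← card_sdiff_of_subset hXV, ← card_powersetCard]
    refine card_le_card fun B hB => ?_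
    obtain ⟨hB, hXB⟩ := (mem_bipartiteBelow _).1 hB
    obtain ⟨hBV, hBc⟩ := mem_powersetCard.1 (hℬ hB)
    exact mem_powersetCard.2 ⟨subset_sdiff.2 ⟨hBV, hXB.symm⟩, hBc⟩

theorem excess_nonpos_of_card_link_le (hU : U ⊆ V) (hUW : Disjoint U W) (hp : #U ≤ p)
    (h : #(link W U ℬ) ≤ #(blocked (V \ (U ∪ W)) (p - #U) (link W U ℬ))) :
    excess V p ℬ U W ≤ 0 := by
  have hle := h.trans (card_le_card (blocked_link_subset hU hUW hp))
  rw [card_link, card_link] at hle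
  unfold excess
  omega

theorem excess_nonpos_of_card_add_le (hℬ : ℬ ⊆ V.powersetCard q) (hU : U ⊆ V) (hW : W ⊆ V)
    (hpq : p + q ≤ #V) (h : q + #U ≤ p + #W) : excess V p ℬ U W ≤ 0 := by
  by_cases hWq : q < #W
  · exact excess_nonpos_of_card_lt hℬ hWq
  by_cases hUW : Disjoint U W
  swap
  · exact excess_nonpos_of_not_disjoint hUW
  refine excess_nonpos_of_card_link_le hU hUW (by omega) ?_
  have hlink : link W U ℬ ⊆ (V \ (U ∪ W)).powersetCard (q - #W) := by
    rw [union_comm]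
    exact link_subset_powersetCard hℬ
  exact card_le_card_blocked_of_le hlink (by omega)
    (by rw [card_sdiff_union hU hW hUW]; omega)

end Blocked

section FinalSegments

variable {α : Type*} [LinearOrder α] {B B' S T : Finset α} {𝒜 ℬ : Finset (Finset α)} {q : ℕ}

/-- `ℬ` is a final segment of the colexicographic order on the sets of size `q`; the counterpart of
`Finset.Colex.IsInitSeg`. -/
def IsFinalSeg (ℬ : Finset (Finset α)) (q : ℕ) : Prop :=
  (ℬ : Set (Finset α)).Sized q ∧
    ∀ ⦃B B'⦄, B ∈ ℬ → toColex B < toColex B' → #B' = q → B' ∈ ℬ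

theorem IsFinalSeg.total (h𝒜 : IsFinalSeg 𝒜 q) (hℬ : IsFinalSeg ℬ q) : 𝒜 ⊆ ℬ ∨ ℬ ⊆ 𝒜 := by
  by_contra! h
  obtain ⟨A, hA, hAℬ⟩ := not_subset.1 h.1
  obtain ⟨B, hB, hB𝒜⟩ := not_subset.1 h.2
  rcases lt_trichotomy (toColex A) (toColex B) with hlt | heq | hlt
  · exact hB𝒜 (h𝒜.2 hA hlt (hℬ.1 hB))
  · exact hAℬ (toColex_inj.1 heq ▸ hB)
  · exact hAℬ (hℬ.2 hB hlt (h𝒜.1 hA))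

theorem IsFinalSeg.subset_of_card_le (h𝒜 : IsFinalSeg 𝒜 q) (hℬ : IsFinalSeg ℬ q)
    (h : #𝒜 ≤ #ℬ) : 𝒜 ⊆ ℬ :=
  (h𝒜.total hℬ).elim id fun hs => (eq_of_subset_of_card_le hs h).symm.subset

theorem subset_of_toColex_le (hT : IsUpperSet (T : Set α)) (hTB : T ⊆ B)
    (h : toColex B ≤ toColex B') : T ⊆ B' := by
  intro x hx
  by_contra hxB'
  obtain ⟨y, -, hyB, hxy⟩ := Colex.toColex_le_toColex.1 h (hTB hx) hxB'
  exact hyB (hTB (hT hxy hx))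

theorem not_disjoint_of_toColex_le (hTS : IsUpperSet (↑(T ∪ S) : Set α)) (hTB : T ⊆ B)
    (hSB : ¬Disjoint S B) (h : toColex B ≤ toColex B') : ¬Disjoint S B' := by
  intro hSB'
  obtain ⟨x, hxS, hxB⟩ := not_disjoint_iff.1 hSB
  obtain ⟨y, hyB', hyB, hxy⟩ := Colex.toColex_le_toColex.1 h hxB (disjoint_left.1 hSB' hxS)
  have hy : y ∈ T ∪ S := mem_coe.1 (hTS hxy (mem_coe.2 (mem_union_right T hxS)))
  rcases mem_union.1 hy with hyT | hyS
  · exact hyB (hTB hyT)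
  · exact disjoint_left.1 hSB' hyS hyB'

variable [Fintype α]

theorem isFinalSeg_slice_powersetCard (hT : IsUpperSet (T : Set α)) (q : ℕ) :
    IsFinalSeg (slice T ∅ (univ.powersetCard q)) q := by
  refine ⟨fun B hB => (mem_powersetCard.1 (slice_subset hB)).2, fun B B' hB hlt hB' => ?_⟩
  obtain ⟨-, hTB, -⟩ := mem_slice.1 hB
  exact mem_slice.2 ⟨mem_powersetCard.2 ⟨subset_univ _, hB'⟩, subset_of_toColex_le hT hTB hlt.le,
    disjoint_empty_right _⟩

theorem isFinalSeg_filter_powersetCard (hT : IsUpperSet (T : Set α))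
    (hTS : IsUpperSet (↑(T ∪ S) : Set α)) (q : ℕ) :
    IsFinalSeg {B ∈ univ.powersetCard q | T ⊆ B ∧ ¬Disjoint S B} q := by
  refine ⟨fun B hB => (mem_powersetCard.1 (filter_subset _ _ hB)).2, fun B B' hB hlt hB' => ?_⟩
  obtain ⟨-, hTB, hSB⟩ := mem_filter.1 hB
  exact mem_filter.2 ⟨mem_powersetCard.2 ⟨subset_univ _, hB'⟩, subset_of_toColex_le hT hTB hlt.le,
    not_disjoint_of_toColex_le hTS hTB hSB hlt.le⟩

theorem IsFinalSeg.subset_of_mem (hℬ : IsFinalSeg ℬ q) (hT : IsUpperSet (T : Set α))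
    (hTq : #T ≤ q) (hcard : #ℬ ≤ (Fintype.card α - #T).choose (q - #T)) (hB : B ∈ ℬ) : T ⊆ B :=
  have hsub := hℬ.subset_of_card_le (isFinalSeg_slice_powersetCard hT q)
    (hcard.trans_eq (card_slice_univ_powersetCard hTq).symm)
  (mem_slice.1 (hsub hB)).2.1

theorem IsFinalSeg.mem_of_subset (hℬ : IsFinalSeg ℬ q) (hT : IsUpperSet (T : Set α))
    (hTq : #T ≤ q) (hcard : (Fintype.card α - #T).choose (q - #T) ≤ #ℬ) (hB : #B = q)
    (hTB : T ⊆ B) : B ∈ ℬ :=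
  have hsub := (isFinalSeg_slice_powersetCard hT q).subset_of_card_le hℬ
    ((card_slice_univ_powersetCard hTq).trans_le hcard)
  hsub (mem_slice.2 ⟨mem_powersetCard.2 ⟨subset_univ _, hB⟩, hTB, disjoint_empty_right _⟩)

theorem toColex_compl_lt {s t : Finset α} (h : toColex s < toColex t) :
    toColex tᶜ < toColex sᶜ := by
  refine lt_of_le_of_ne (Colex.toColex_le_toColex.2 fun a ha ha' => ?_) fun he => h.ne ?_
  · rw [mem_compl] at ha ha'
    obtain ⟨b, hbt, hbs, hab⟩ := Colex.toColex_le_toColex.1 h.le (not_not.1 ha') ha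
    exact ⟨b, mem_compl.2 hbs, by simpa using hbt, hab⟩
  · rw [toColex_inj, compl_inj_iff] at he
    rw [he]

theorem isFinalSeg_compls (h : Colex.IsInitSeg 𝒜 q) :
    IsFinalSeg 𝒜ᶜˢ (Fintype.card α - q) := by
  refine ⟨h.1.compls, fun B B' hB hlt hB' => ?_⟩
  rw [mem_compls] at hB ⊢
  have := card_le_univ Bᶜ
  rw [h.1 hB] at this
  exact h.2 hB ⟨toColex_compl_lt hlt, by rw [card_compl, hB']; omega⟩

theorem exists_isInitSeg_card {N : ℕ} (hN : N ≤ (Fintype.card α).choose q) :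
    ∃ 𝒞 : Finset (Finset α), Colex.IsInitSeg 𝒞 q ∧ #𝒞 = N := by
  induction N with
  | zero => exact ⟨∅, Colex.isInitSeg_empty, rfl⟩
  | succ N ih =>
    obtain ⟨𝒞, h𝒞, hcard⟩ := ih (by omega)
    have hne : (univ.powersetCard q \ 𝒞).Nonempty := by
      refine sdiff_nonempty.2 fun hsub => ?_
      have := card_le_card hsub
      rw [card_powersetCard, card_univ] at this
      omega
    obtain ⟨s, hs, hmin⟩ := exists_min_image _ (toColex : Finset α → Colex (Finset α)) hne
    obtain ⟨hs, hs𝒞⟩ := mem_sdiff.1 hs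
    refine ⟨insert s 𝒞, ⟨fun t ht => ?_, fun t u ht ⟨hut, hu⟩ => ?_⟩,
      by rw [card_insert_of_notMem hs𝒞, hcard]⟩
    · rcases mem_insert.1 (mem_coe.1 ht) with rfl | ht
      · exact (mem_powersetCard.1 hs).2
      · exact h𝒞.1 ht
    · refine mem_insert_of_mem ?_
      rcases mem_insert.1 ht with rfl | ht
      · by_contra hu𝒞
        exact (hmin u (mem_sdiff.2 ⟨mem_powersetCard.2 ⟨subset_univ _, hu⟩, hu𝒞⟩)).not_gt hut
      · exact h𝒞.2 ht ⟨hut, hu⟩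

end FinalSegments

section KruskalKatona

variable {p q n : ℕ}

theorem blocked_univ_eq_shadow_compls {α : Type*} [DecidableEq α] [Fintype α]
    {𝒜 : Finset (Finset α)} (h𝒜 : (𝒜 : Set (Finset α)).Sized q)
    (hpq : p + q ≤ Fintype.card α) :
    blocked univ p 𝒜 = ∂^[Fintype.card α - q - p] 𝒜ᶜˢ := by
  ext X
  simp only [mem_blocked, mem_shadow_iterate_iff_exists_mem_card_add, exists_compls_iff,
    subset_univ, true_and, subset_compl_iff_disjoint_right, card_compl]
  constructor
  · rintro ⟨hX, B, hB, hXB⟩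
    exact ⟨B, hB, hXB, by rw [h𝒜 hB]; omega⟩
  · rintro ⟨B, hB, hXB, hX⟩
    rw [h𝒜 hB] at hX
    exact ⟨by omega, B, hB, hXB⟩

theorem exists_isFinalSeg_fin {𝒜 : Finset (Finset (Fin n))} (h𝒜 : 𝒜 ⊆ univ.powersetCard q)
    (hpq : p + q ≤ n) : ∃ ℬ : Finset (Finset (Fin n)), IsFinalSeg ℬ q ∧ #ℬ = #𝒜 ∧
      #(blocked univ p ℬ) ≤ #(blocked univ p 𝒜) := by
  have h𝒜q : (𝒜 : Set (Finset (Fin n))).Sized q := fun A hA => (mem_powersetCard.1 (h𝒜 hA)).2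
  have hle : #𝒜 ≤ (Fintype.card (Fin n)).choose (n - q) := by
    rw [Fintype.card_fin, Nat.choose_symm (by omega)]
    simpa using card_le_card h𝒜
  obtain ⟨𝒞, h𝒞, hcard⟩ := exists_isInitSeg_card hle
  have hℬ : IsFinalSeg 𝒞ᶜˢ q := by
    convert isFinalSeg_compls h𝒞
    rw [Fintype.card_fin]
    omega
  refine ⟨𝒞ᶜˢ, hℬ, by rw [card_compls, hcard], ?_⟩
  have hpq' : p + q ≤ Fintype.card (Fin n) := hpq.trans_eq (Fintype.card_fin n).symm
  rw [blocked_univ_eq_shadow_compls hℬ.1 hpq', blocked_univ_eq_shadow_compls h𝒜q hpq',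
    compls_compls]
  have h𝒜compls := h𝒜q.compls
  rw [Fintype.card_fin] at h𝒜compls ⊢
  exact iterated_kk h𝒜compls (by rw [card_compls, hcard]) h𝒞

variable {α : Type*} [DecidableEq α] {V : Finset α} {ℬ : Finset (Finset α)}

theorem card_blocked_map {β : Type*} [DecidableEq β] (e : β ↪ α) (V : Finset β)
    (𝒜 : Finset (Finset β)) :
    #(blocked (V.map e) p (𝒜.map (mapEmbedding e).toEmbedding)) = #(blocked V p 𝒜) := by
  rw [← card_map (mapEmbedding e).toEmbedding]
  congr 1
  unfold blocked
  rw [powersetCard_map, filter_map]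
  simp

/-- The Kruskal–Katona theorem, in Hilton's form for cross-intersecting families. -/
theorem exists_isFinalSeg (hℬ : ℬ ⊆ V.powersetCard q) (hpq : p + q ≤ #V) :
    ∃ ℬ' : Finset (Finset (Fin #V)), IsFinalSeg ℬ' q ∧ #ℬ' = #ℬ ∧
      #(blocked univ p ℬ') ≤ #(blocked V p ℬ) := by
  let e : Fin #V ↪ α := V.equivFin.symm.toEmbedding.trans (Function.Embedding.subtype (· ∈ V))
  have he : univ.map e = V := by
    rw [← map_map, map_univ_equiv, univ_eq_attach, attach_map_val]
  obtain ⟨𝒜, h𝒜, rfl⟩ : ∃ 𝒜 ⊆ univ.powersetCard q, ℬ = 𝒜.map (mapEmbedding e).toEmbedding := by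
    rwa [← he, powersetCard_map, subset_map_iff] at hℬ
  obtain ⟨ℬ', hℬ', hcard, hle⟩ := exists_isFinalSeg_fin h𝒜 hpq
  refine ⟨ℬ', hℬ', by rw [hcard, card_map], hle.trans_eq ?_⟩
  rw [← card_blocked_map e, he]

/-- The `j` largest elements of `Fin n`. -/
def topElems (n j : ℕ) : Finset (Fin n) := {i | n ≤ i + j}

theorem mem_topElems {j : ℕ} {i : Fin n} : i ∈ topElems n j ↔ n ≤ i + j := by
  simp [topElems]

theorem card_topElems {j : ℕ} (hj : j ≤ n) : #(topElems n j) = j := by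
  have h : (topElems n j).map Fin.valEmbedding = Ico (n - j) n := by
    ext a
    simp only [mem_map, mem_topElems, Fin.valEmbedding_apply, mem_Ico]
    exact ⟨fun ⟨i, _, _⟩ => by omega, fun ⟨_, han⟩ => ⟨⟨a, han⟩, by simp; omega, rfl⟩⟩
  rw [← card_map Fin.valEmbedding, h, Nat.card_Ico]
  omega

theorem isUpperSet_topElems (n j : ℕ) : IsUpperSet (topElems n j : Set (Fin n)) := by
  intro a b hab ha
  simp only [mem_coe, mem_topElems] at ha ⊢
  have : (a : ℕ) ≤ b := hab
  omega

theorem topElems_mono (n : ℕ) : Monotone (topElems n) := by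
  intro i j hij a ha
  rw [mem_topElems] at ha ⊢
  omega

theorem card_le_card_blocked (hℬ : ℬ ⊆ V.powersetCard q) (hpq : p + q ≤ #V) (hle : p ≤ q)
    (hcard : #ℬ ≤ (#V - q + p).choose p) : #ℬ ≤ #(blocked V p ℬ) := by
  obtain ⟨ℬ', hℬ', hcard', hblocked⟩ := exists_isFinalSeg hℬ hpq
  generalize #V = n at *
  set T := topElems n (q - p)
  have hTc : #T = q - p := card_topElems (by omega)
  have hslice : slice T ∅ ℬ' = ℬ' := filter_true_of_mem fun B hB =>
    ⟨hℬ'.subset_of_mem (isUpperSet_topElems n _) (by omega)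
      (by rw [hcard', hTc, Fintype.card_fin]; convert hcard using 2 <;> omega) hB,
      disjoint_empty_right _⟩
  have hexcess : excess univ p ℬ' ∅ T ≤ 0 :=
    excess_nonpos_of_card_add_le (q := q)
      (fun B hB => mem_powersetCard.2 ⟨subset_univ _, hℬ'.1 hB⟩)
      (empty_subset _) (subset_univ _) (by simpa using hpq) (by rw [hTc, card_empty]; omega)
  unfold excess at hexcess
  rw [hslice] at hexcess
  have := card_le_card (slice_subset (U := ∅) (W := T) (𝒢 := blocked univ p ℬ'))
  omega

theorem excess_nonpos_of_card_le {U W : Finset α} (hℬ : ℬ ⊆ V.powersetCard q) (hU : U ⊆ V)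
    (hW : W ⊆ V) (hpq : p + q ≤ #V) (hp : #U ≤ p)
    (hcard : #ℬ ≤ (#V - q + p - 2 * #U).choose (p - #U)) : excess V p ℬ U W ≤ 0 := by
  by_cases hWq : q < #W
  · exact excess_nonpos_of_card_lt hℬ hWq
  by_cases hlarge : q + #U ≤ p + #W
  · exact excess_nonpos_of_card_add_le hℬ hU hW hpq hlarge
  by_cases hUW : Disjoint U W
  swap
  · exact excess_nonpos_of_not_disjoint hUW
  have hlink : link W U ℬ ⊆ (V \ (U ∪ W)).powersetCard (q - #W) := by
    rw [union_comm]
    exact link_subset_powersetCard hℬ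
  have hVUW := card_sdiff_union hU hW hUW
  refine excess_nonpos_of_card_link_le hU hUW hp
    (card_le_card_blocked hlink (by omega) (by omega) ?_)
  rw [card_link, hVUW]
  refine (card_le_card slice_subset).trans (hcard.trans_eq ?_)
  congr 1
  omega

theorem choose_le_card_blocked (hℬ : ℬ ⊆ V.powersetCard q) (hpq : p + q ≤ #V) (hq : 1 ≤ q)
    (hcard : (#V - 1).choose (q - 1) ≤ #ℬ) : (#V - 1).choose p ≤ #(blocked V p ℬ) := by
  obtain ⟨ℬ', hℬ', hcard', hblocked⟩ := exists_isFinalSeg hℬ hpq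
  refine le_trans ?_ hblocked
  generalize #V = n at *
  have hTc : #(topElems n 1) = 1 := card_topElems (by omega)
  have hmem : ∀ B : Finset (Fin n), #B = q → topElems n 1 ⊆ B → B ∈ ℬ' := fun B =>
    hℬ'.mem_of_subset (isUpperSet_topElems n 1) (by omega)
      (by rw [hcard', hTc, Fintype.card_fin]; exact hcard)
  have hc : #((univ \ topElems n 1).powersetCard p) = (n - 1).choose p := by
    rw [card_powersetCard, card_sdiff_of_subset (subset_univ _), hTc, card_univ, Fintype.card_fin]
  rw [← hc]
  refine card_le_card fun X hX => ?_
  obtain ⟨hXT, hXc⟩ := mem_powersetCard.1 hX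
  have hXT' : Disjoint X (topElems n 1) := (subset_sdiff.1 hXT).2
  obtain ⟨B, hTB, hBX, hBc⟩ := exists_subsuperset_card_eq (n := q)
    (subset_compl_iff_disjoint_left.2 hXT') (by omega)
    (by rw [card_compl, Fintype.card_fin, hXc]; omega)
  exact mem_blocked.2 ⟨⟨subset_univ _, hXc⟩, B, hmem B hBc hTB,
    (subset_compl_iff_disjoint_left.1 hBX)⟩

end KruskalKatona

section Estimates

variable {α : Type*} [DecidableEq α] {V : Finset α} {ℬ : Finset (Finset α)} {m p q : ℕ}

theorem excess_le_one_sub_choose {B U : Finset α} (hℬ : ℬ ⊆ V.powersetCard q) (hB : B ∈ ℬ)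
    (hU : U ⊆ V) (hUB : Disjoint U B) (hp : #U ≤ p) :
    excess V p ℬ U B ≤ 1 - ((#V - #U - q).choose (p - #U) : ℕ) := by
  obtain ⟨hBV, hBc⟩ := mem_powersetCard.1 (hℬ hB)
  have hone : #(slice B U ℬ) ≤ 1 := card_slice_le_one hℬ hBc.ge
  have hle := excess_le_of_exists_subset hU hBV hUB hp ⟨B, hB, Subset.rfl⟩
  rw [hBc] at hle
  omega

theorem excess_singleton_le_sub_choose {B W : Finset α} {z : α} (hℬ : ℬ ⊆ V.powersetCard q)
    (hpair : ∀ i ∈ V, ∀ j ∈ V, i ≠ j → ∀ W ⊆ V, excess V p ℬ {i, j} W ≤ 0) (hp : 1 ≤ p)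
    (hW : W ⊆ V) (hB : B ∈ ℬ) (hz : z ∈ V) (hzB : z ∉ B) (hzW : z ∉ W) :
    excess V p ℬ {z} W ≤ #(slice (W ∪ B) {z} ℬ) - ((#V - 1 - #(W ∪ B)).choose (p - 1) : ℕ) := by
  have hBV := (mem_powersetCard.1 (hℬ hB)).1
  have hzWB : z ∉ W ∪ B := by simp [hzW, hzB]
  calc excess V p ℬ {z} W ≤ excess V p ℬ {z} (W ∪ B) :=
        excess_le_excess_of_subset subset_union_left fun i hi W' _ hW' _ =>
          hpair i (union_subset hW hBV hi) z hz (fun h => hzWB (h ▸ hi)) W'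
            (hW'.trans (union_subset hW hBV))
    _ ≤ _ := excess_le_of_exists_subset (singleton_subset_iff.2 hz) (union_subset hW hBV)
        (disjoint_singleton_left.2 hzWB) hp ⟨B, hB, subset_union_right⟩

/-- For `p = k - 1`, the number of `k`-subsets of `[m + k + 1]` that contain `1` but do not belong
to `J_3`: those disjoint from `I_1`, and those that meet `I_1` only in `2` or `3` and are disjoint
from `I_3`, split according to whether they contain `2`. -/
def deficitJ (m p : ℕ) : ℕ :=
  m.choose p + (m - 1).choose (p - 1) + (m - 2).choose (p - 1)

theorem card_add_deficitJ_le_of_excess_nonpos {A B : Finset α}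
    (hℬ : ℬ ⊆ V.powersetCard q) (hV : #V = m + q) (hp : 2 ≤ p)
    (hsingle : ∀ i ∈ V, ∀ W ⊆ V, excess V p ℬ {i} W ≤ 0)
    (hpair : ∀ i ∈ V, ∀ j ∈ V, i ≠ j → ∀ W ⊆ V, excess V p ℬ {i, j} W ≤ 0)
    (hA : A ∈ ℬ) (hB : B ∈ ℬ) (hAB : #(A ∩ B) + 2 ≤ q) :
    #ℬ + deficitJ m p ≤ #(blocked V p ℬ) + 2 := by
  obtain ⟨hAV, hAc⟩ := mem_powersetCard.1 (hℬ hA)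
  have hBc := (mem_powersetCard.1 (hℬ hB)).2
  obtain ⟨x, hx, y, hy, hxy⟩ : ∃ x ∈ A \ B, ∃ y ∈ A \ B, x ≠ y := by
    refine one_lt_card.1 ?_
    have := card_sdiff_add_card_inter A B
    omega
  rw [mem_sdiff] at hx hy
  have hchain : ∀ {W T}, W ⊆ T → T ⊆ A → excess V p ℬ ∅ W ≤ excess V p ℬ ∅ T := fun hW hT =>
    excess_le_excess_of_subset hW fun i hi W' _ hW' _ =>
      hsingle i (hAV (hT hi)) W' (hW'.trans (hT.trans hAV))
  have hxI : insert x (A ∩ B) ⊆ A := insert_subset hx.1 inter_subset_left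
  have hstart := hchain (empty_subset (A ∩ B)) inter_subset_left
  have hend := hchain (insert_subset hy.1 hxI) Subset.rfl
  have hAleaf := excess_le_one_sub_choose (p := p) hℬ hA (empty_subset V) (disjoint_empty_left A)
    (by simp)
  have hxleaf : excess V p ℬ {x} (A ∩ B) ≤ 1 - ((m - 1).choose (p - 1) : ℕ) := by
    have h := excess_singleton_le_sub_choose hℬ hpair (by omega) (inter_subset_left.trans hAV)
      hB (hAV hx.1) hx.2 (fun h => hx.2 (mem_inter.1 h).2)
    have hone := card_slice_le_one (U := {x}) hℬ hBc.ge
    rw [union_eq_right.2 inter_subset_right, hBc] at h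
    rw [show m - 1 = #V - 1 - q by omega]
    omega
  have hyleaf : excess V p ℬ {y} (insert x (A ∩ B)) ≤ -((m - 2).choose (p - 1) : ℕ) := by
    have h := excess_singleton_le_sub_choose hℬ hpair (by omega) (hxI.trans hAV)
      hB (hAV hy.1) hy.2 (by simp [hxy.symm, hy.2])
    rw [insert_union, union_eq_right.2 inter_subset_right, card_insert_of_notMem hx.2, hBc,
      slice_eq_empty_of_card_lt hℬ (by rw [card_insert_of_notMem hx.2]; omega), card_empty] at h
    rw [show m - 2 = #V - 1 - (q + 1) by omega]
    omega
  have hbx := excess_insert_add_excess_insert V p ℬ ∅ (A ∩ B) x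
  have hby := excess_insert_add_excess_insert V p ℬ ∅ (insert x (A ∩ B)) y
  rw [insert_empty_eq] at hbx hby
  rw [excess_empty_empty] at hstart
  rw [card_empty, hV, show m + q - 0 - q = m by omega, Nat.sub_zero] at hAleaf
  rw [deficitJ]
  omega

theorem card_add_deficitJ_le_of_card_inter_add_two_le {A B : Finset α}
    (hℬ : ℬ ⊆ V.powersetCard q) (hV : #V = m + q) (hpm : p ≤ m) (hp : 2 ≤ p)
    (hcard₁ : #ℬ ≤ (m + p - 2).choose (p - 1)) (hcard₂ : #ℬ ≤ (m + p - 4).choose (p - 2))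
    (hA : A ∈ ℬ) (hB : B ∈ ℬ) (hAB : #(A ∩ B) + 2 ≤ q) :
    #ℬ + deficitJ m p ≤ #(blocked V p ℬ) + 2 :=
  card_add_deficitJ_le_of_excess_nonpos hℬ hV hp
    (fun i hi W hW => excess_nonpos_of_card_le hℬ (singleton_subset_iff.2 hi) hW (by omega)
      (by simp; omega) (hcard₁.trans_eq (by rw [card_singleton]; congr 1; omega)))
    (fun i hi j hj hij W hW => excess_nonpos_of_card_le hℬ (by simp [insert_subset_iff, hi, hj])
      hW (by omega) (by rw [card_pair hij]; omega)
      (hcard₂.trans_eq (by rw [card_pair hij]; congr 1; omega)))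
    hA hB hAB

theorem excess_singleton_le_one_sub_choose {B W : Finset α} {s : α} (hℬ : ℬ ⊆ V.powersetCard q)
    (hpq : p + q ≤ #V) (hp : 1 ≤ p) (hs : s ∈ V) (hB : B ∈ ℬ) (hsB : s ∉ B) (hWB : W ⊆ B)
    (hW : q + 2 ≤ p + #W) :
    excess V p ℬ {s} W ≤ 1 - ((#V - 1 - q).choose (p - 1) : ℕ) := by
  have hBV := (mem_powersetCard.1 (hℬ hB)).1
  have hle : excess V p ℬ {s} W ≤ excess V p ℬ {s} B :=
    excess_le_excess_of_subset hWB fun i hi W' hWW' hW' _ =>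
      excess_nonpos_of_card_add_le hℬ (insert_subset (hBV hi) (singleton_subset_iff.2 hs))
        (hW'.trans hBV) hpq (by
          have := card_le_card hWW'
          have := card_le_two (a := i) (b := s)
          omega)
  exact hle.trans (excess_le_one_sub_choose hℬ hB (singleton_subset_iff.2 hs)
    (disjoint_singleton_left.2 hsB) (by simpa using hp))

theorem card_add_le_of_erase_mem {D S : Finset α} (hℬ : ℬ ⊆ V.powersetCard q) (hV : #V = m + q)
    (hpm : p ≤ m) (hp : 4 ≤ p) (hDV : D ⊆ V) (hSD : S ⊆ D) (hS : #S = 3)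
    (herase : ∀ s ∈ S, D.erase s ∈ ℬ) (hchain : excess V p ℬ ∅ ∅ ≤ excess V p ℬ ∅ (D \ S)) :
    #ℬ + (m.choose p + 2 * (m - 1).choose (p - 1)) ≤ #(blocked V p ℬ) + 3 := by
  have hD : q + 1 = #(D \ S) + 3 := by
    obtain ⟨s, hs⟩ : S.Nonempty := card_pos.1 (by omega)
    rw [← (mem_powersetCard.1 (hℬ (herase s hs))).2, card_erase_add_one (hSD hs), ← hS,
      card_sdiff_add_card_eq_card hSD]
  have hleaf : ∀ s ∈ S, ∀ W, D \ S ⊆ W → W ⊆ D.erase s →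
      excess V p ℬ {s} W ≤ 1 - ((m - 1).choose (p - 1) : ℕ) := by
    intro s hs W hSW hW
    have := card_le_card hSW
    rw [show m - 1 = #V - 1 - q by omega]
    exact excess_singleton_le_one_sub_choose hℬ (by omega) (by omega) (hDV (hSD hs))
      (herase s hs) (notMem_erase s D) hW (by omega)
  obtain ⟨a, b, c, hab, hac, hbc, rfl⟩ := card_eq_three.1 hS
  set T := D \ {a, b, c}
  have hT : insert b (insert a T) = D.erase c := by
    ext i
    have := @hSD i
    simp only [T, mem_insert, mem_sdiff, mem_singleton, mem_erase] at this ⊢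
    grind
  have haleaf := hleaf a (by simp) T Subset.rfl fun i hi => by
    simp only [T, mem_sdiff, mem_insert, not_or] at hi
    exact mem_erase.2 ⟨hi.2.1, hi.1⟩
  have hbleaf := hleaf b (by simp) (insert a T) (subset_insert a T) fun i hi => by
    have := @hSD i
    simp only [T, mem_sdiff, mem_insert, mem_singleton, mem_erase] at hi this ⊢
    grind
  have hcleaf := excess_le_one_sub_choose (p := p) hℬ (herase c (by simp)) (empty_subset V)
    (disjoint_empty_left _) (by simp)
  have hba := excess_insert_add_excess_insert V p ℬ ∅ T a
  have hbb := excess_insert_add_excess_insert V p ℬ ∅ (insert a T) b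
  rw [insert_empty_eq] at hba hbb
  rw [hT] at hbb
  rw [excess_empty_empty] at hchain
  rw [card_empty, hV, show m + q - 0 - q = m by omega, Nat.sub_zero] at hcleaf
  omega

theorem excess_le_of_insert_mem {U W : Finset α} (hℬ : ℬ ⊆ V.powersetCard q) (hpq : p + q ≤ #V)
    (hU : U ⊆ V) (hW : W ⊆ V) (hUW : Disjoint U W) (hp : #U ≤ p) (hWq : #W + 1 = q)
    (hins : ∀ c ∈ V, c ∉ W → insert c W ∈ ℬ) :
    excess V p ℬ U W ≤
      (#V - #U - #W : ℕ) - ((#V - #U - #W).choose (p - #U) : ℕ) := by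
  refine (excess_le_of_slice_subset_blocked hU hW hUW hp fun X hX => ?_).trans ?_
  · obtain ⟨hX, -, hXW⟩ := mem_slice.1 hX
    obtain ⟨hXV, hXc⟩ := mem_powersetCard.1 hX
    obtain ⟨c, hcV, hc⟩ := exists_mem_notMem_of_card_lt_card (s := X ∪ W) (t := V)
      ((card_union_le X W).trans_lt (by omega))
    rw [mem_union, not_or] at hc
    exact mem_blocked.2
      ⟨⟨hXV, hXc⟩, insert c W, hins c hcV hc.2, disjoint_insert_right.2 ⟨hc.1, hXW⟩⟩
  · have hle := card_le_card (filter_subset_filter (fun B => W ⊆ B ∧ Disjoint B U) hℬ)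
    have hcard := card_slice_powersetCard (p := q) hW hU hUW.symm (by omega)
    rw [show q - #W = 1 by omega, Nat.choose_one_right] at hcard
    change #(slice W U ℬ) ≤ #(slice W U (V.powersetCard q)) at hle
    omega

theorem card_add_le_of_mem_of_not_disjoint {T : Finset α} {a b : α} (hℬ : ℬ ⊆ V.powersetCard q)
    (hV : #V = m + q) (hpm : p ≤ m) (hp : 4 ≤ p) (hT : T ⊆ V) (hTq : #T + 2 = q)
    (ha : a ∈ V \ T) (hb : b ∈ V \ T) (hab : a ≠ b)
    (hmem : ∀ B ∈ V.powersetCard q, T ⊆ B → ¬Disjoint {a, b} B → B ∈ ℬ)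
    (hchain : excess V p ℬ ∅ ∅ ≤ excess V p ℬ ∅ T) :
    #ℬ + (m.choose (p - 1) + (m + 1).choose p) ≤ #(blocked V p ℬ) + (2 * m + 1) := by
  rw [mem_sdiff] at ha hb
  have hins : ∀ x ∈ ({a, b} : Finset α), x ∈ V ∧ x ∉ T ∧
      ∀ c ∈ V, c ∉ insert x T → insert c (insert x T) ∈ ℬ := by
    intro x hx
    have hxV : x ∈ V ∧ x ∉ T := by grind
    refine ⟨hxV.1, hxV.2, fun c hcV hc => hmem _ (mem_powersetCard.2 ⟨?_, ?_⟩) ?_ ?_⟩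
    · exact insert_subset hcV (insert_subset hxV.1 hT)
    · rw [card_insert_of_notMem hc, card_insert_of_notMem hxV.2, ← hTq]
    · exact (subset_insert x T).trans (subset_insert c _)
    · exact not_disjoint_iff.2 ⟨x, hx, by simp⟩
  obtain ⟨haV, haT, hains⟩ := hins a (by simp)
  obtain ⟨hbV, hbT, hbins⟩ := hins b (by simp)
  have hbranch_a := excess_insert_add_excess_insert V p ℬ ∅ T a
  have hbranch_b := excess_insert_add_excess_insert V p ℬ {a} T b
  have hab_leaf : excess V p ℬ (insert b {a}) T ≤ 0 :=
    excess_nonpos_of_card_add_le hℬ (by simp [insert_subset_iff, haV, hbV]) hT (by omega) (by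
      rw [card_pair hab.symm]; omega)
  have ha_leaf := excess_le_of_insert_mem (p := p) (U := {a}) (W := insert b T) hℬ (by omega)
    (singleton_subset_iff.2 haV) (insert_subset hbV hT) (by simp [hab, haT])
    (by rw [card_singleton]; omega) (by rw [card_insert_of_notMem hbT]; omega) hbins
  have hleaf := excess_le_of_insert_mem (p := p) (U := ∅) (W := insert a T) hℬ (by omega)
    (empty_subset V) (insert_subset haV hT) (disjoint_empty_left _) (by simp)
    (by rw [card_insert_of_notMem haT]; omega) hains
  rw [insert_empty_eq] at hbranch_a
  rw [card_singleton, card_insert_of_notMem hbT, show #V - 1 - (#T + 1) = m by omega] at ha_leaf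
  rw [card_empty, card_insert_of_notMem haT, show #V - 0 - (#T + 1) = m + 1 by omega,
    Nat.sub_zero] at hleaf
  rw [excess_empty_empty] at hchain
  omega

theorem card_filter_subset_not_disjoint {S T : Finset α} (hS : S ⊆ V) (hT : T ⊆ V)
    (hTS : Disjoint T S) (hScard : #S = 2) (hTq : #T + 2 = q) (hV : #V = m + q) :
    #{B ∈ V.powersetCard q | T ⊆ B ∧ ¬Disjoint S B} = 2 * m + 1 := by
  have hall := card_slice_powersetCard (p := q) hT (empty_subset V) (disjoint_empty_right T)
    (by omega)
  have hdisj := card_slice_powersetCard (p := q) hT hS hTS (by omega)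
  have hsplit := card_filter_add_card_filter_not (s := slice T ∅ (V.powersetCard q)) (Disjoint · S)
  simp only [slice, filter_filter, disjoint_empty_right, and_true, disjoint_comm (b := S)]
    at hall hdisj hsplit
  rw [hall, hdisj, card_empty, hV, hScard, show m + q - #T - 0 = m + 2 by omega,
    show m + q - #T - 2 = m by omega, show q - #T = 2 by omega] at hsplit
  have hpascal : (m + 2).choose 2 = m.choose 2 + (2 * m + 1) := by
    have h₁ : (m + 2).choose 2 = (m + 1).choose 1 + (m + 1).choose 2 := Nat.choose_succ_succ' _ 1
    have h₂ : (m + 1).choose 2 = m.choose 1 + m.choose 2 := Nat.choose_succ_succ' m 1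
    rw [h₁, h₂, Nat.choose_one_right, Nat.choose_one_right]
    omega
  omega

theorem card_add_le_of_isFinalSeg {ℬ : Finset (Finset (Fin (m + q)))} (hℬ : IsFinalSeg ℬ q)
    (hpm : p ≤ m) (hp : 4 ≤ p) {j : ℕ} (hj : j + 2 ≤ q) (hqj : q + 1 ≤ p + j)
    (hle : #ℬ ≤ (m + q - j).choose (q - j)) (hge : 2 * m + 1 ≤ #ℬ) :
    #ℬ + (m.choose (p - 1) + (m + 1).choose p) ≤ #(blocked univ p ℬ) + (2 * m + 1) := by
  have hsub : ℬ ⊆ univ.powersetCard q := fun B hB =>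
    mem_powersetCard.2 ⟨subset_univ _, hℬ.1 hB⟩
  have hV : #(univ : Finset (Fin (m + q))) = m + q := by simp
  set T := topElems (m + q) (q - 2)
  set S := topElems (m + q) q \ T
  have hTS : T ∪ S = topElems (m + q) q := union_sdiff_of_subset (topElems_mono _ (by omega))
  have hTc : #T = q - 2 := card_topElems (by omega)
  have hSc : #S = 2 := by
    rw [card_sdiff_of_subset (topElems_mono _ (by omega)), hTc, card_topElems (by omega)]
    omega
  have hmem : ∀ B ∈ univ.powersetCard q, T ⊆ B → ¬Disjoint S B → B ∈ ℬ := fun B hB hTB hSB =>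
    (isFinalSeg_filter_powersetCard (isUpperSet_topElems _ _)
      (hTS ▸ isUpperSet_topElems _ _) q).subset_of_card_le hℬ
      (by rwa [card_filter_subset_not_disjoint (m := m) (subset_univ S) (subset_univ T)
        disjoint_sdiff hSc (by omega) hV]) (mem_filter.2 ⟨hB, hTB, hSB⟩)
  have hjB : ∀ B ∈ ℬ, topElems (m + q) j ⊆ B := fun B =>
    hℬ.subset_of_mem (isUpperSet_topElems _ j) (by rw [card_topElems (by omega)]; omega)
      (by rwa [card_topElems (by omega), Fintype.card_fin])
  have hchain_j : excess univ p ℬ ∅ ∅ ≤ excess univ p ℬ ∅ (topElems (m + q) j) :=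
    excess_le_excess_of_subset (empty_subset _) fun i hi _ _ _ _ =>
      excess_nonpos_of_forall_not_disjoint fun B hB _ =>
        not_disjoint_iff.2 ⟨i, hjB B hB hi, mem_insert_self i ∅⟩
  have hchain_T : excess univ p ℬ ∅ (topElems (m + q) j) ≤ excess univ p ℬ ∅ T :=
    excess_le_excess_of_subset (topElems_mono _ (by omega)) fun i _ W' hW' _ _ =>
      excess_nonpos_of_card_add_le hsub (subset_univ _) (subset_univ _) (by omega) (by
        have := card_le_card hW'
        rw [card_topElems (by omega)] at this
        rw [insert_empty_eq, card_singleton]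
        omega)
  obtain ⟨a, b, hab, hSab⟩ := card_eq_two.1 hSc
  have hSmem : ∀ x ∈ S, x ∈ univ \ T := fun x hx => mem_sdiff.2 ⟨mem_univ x, (mem_sdiff.1 hx).2⟩
  exact card_add_le_of_mem_of_not_disjoint hsub hV hpm hp (subset_univ T) (by omega)
    (hSmem a (by simp [hSab])) (hSmem b (by simp [hSab])) hab (hSab ▸ hmem)
    (hchain_j.trans hchain_T)

theorem card_add_le_of_two_mul_lt_card (hℬ : ℬ ⊆ V.powersetCard q) (hV : #V = m + q)
    (hpm : p ≤ m) (hp : 4 ≤ p) {j : ℕ} (hj : j + 2 ≤ q) (hqj : q + 1 ≤ p + j)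
    (hle : #ℬ ≤ (m + q - j).choose (q - j)) (hge : 2 * m + 1 ≤ #ℬ) :
    #ℬ + (m.choose (p - 1) + (m + 1).choose p) ≤ #(blocked V p ℬ) + (2 * m + 1) := by
  obtain ⟨ℬ', hℬ', hcard, hblocked⟩ := exists_isFinalSeg (p := p) hℬ (by omega)
  generalize #V = n at *
  subst hV
  have := card_add_le_of_isFinalSeg hℬ' hpm hp hj hqj (by omega) (by omega)
  omega

theorem exists_erase_union_eq {A B : Finset α} (hA : #A = q) (hAB : #(A ∩ B) + 1 = q) :
    ∃ a ∈ A \ B, (A ∪ B).erase a = B := by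
  obtain ⟨a, ha⟩ := card_eq_one.1 (show #(A \ B) = 1 by
    have := card_sdiff_add_card_inter A B
    omega)
  refine ⟨a, by simp [ha], ?_⟩
  rw [← sdiff_singleton_eq_erase, ← ha, ← sdiff_union_self_eq_union]
  exact union_sdiff_cancel_left sdiff_disjoint

theorem exists_erase_mem_of_not_inter_subset {A B C : Finset α} (hc : ∀ A ∈ ℬ, #A = q)
    (hpair : ∀ A ∈ ℬ, ∀ B ∈ ℬ, q ≤ #(A ∩ B) + 1) (hA : A ∈ ℬ) (hB : B ∈ ℬ) (hC : C ∈ ℬ)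
    (hAB : #(A ∩ B) + 1 = q) (hABC : ¬A ∩ B ⊆ C) :
    ∃ S ⊆ A ∪ B, #S = 3 ∧ ∀ s ∈ S, (A ∪ B).erase s ∈ ℬ := by
  obtain ⟨a, ha, haB⟩ := exists_erase_union_eq (hc A hA) hAB
  obtain ⟨b, hb, hbA⟩ := exists_erase_union_eq (hc B hB) (inter_comm A B ▸ hAB)
  rw [union_comm] at hbA
  obtain ⟨s, hs, hsC⟩ := not_subset.1 hABC
  have herase_subset : ∀ E ∈ ℬ, s ∈ E → E.erase s ⊆ C := fun E hE hsE => by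
    have hsub : E ∩ C ⊆ E.erase s := fun i hi =>
      mem_erase.2 ⟨fun h => hsC (h ▸ (mem_inter.1 hi).2), (mem_inter.1 hi).1⟩
    have := hpair E hE C hC
    rw [← eq_of_subset_of_card_le hsub (by rw [card_erase_of_mem hsE, hc E hE]; omega)]
    exact inter_subset_right
  rw [mem_sdiff] at ha hb
  rw [mem_inter] at hs
  have hsub : (A ∪ B).erase s ⊆ C := by
    rw [erase_union_distrib]
    exact union_subset (herase_subset A hA hs.1) (herase_subset B hB hs.2)
  have hC' : (A ∪ B).erase s = C := eq_of_subset_of_card_le hsub (by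
    rw [hc C hC, card_erase_of_mem (mem_union_left _ hs.1), card_union, hc A hA, hc B hB]
    omega)
  refine ⟨{a, b, s}, by simp [insert_subset_iff, ha.1, hb.1, hs.1], card_eq_three.2
    ⟨a, b, s, fun h => ha.2 (h ▸ hb.1), fun h => ha.2 (h ▸ hs.2), fun h => hb.2 (h ▸ hs.1), rfl⟩,
    ?_⟩
  simp [haB, hbA, hC', hA, hB, hC]

theorem exists_card_inter_or_exists_erase_mem (hℬ : ℬ ⊆ V.powersetCard q) (hq : 1 ≤ q)
    (hne : ℬ.Nonempty) (h : ∀ S, #S + 1 = q → ∃ B ∈ ℬ, ¬S ⊆ B) :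
    (∃ A ∈ ℬ, ∃ B ∈ ℬ, #(A ∩ B) + 2 ≤ q) ∨
      ∃ D ⊆ V, ∃ S ⊆ D, #S = 3 ∧ ∀ s ∈ S, D.erase s ∈ ℬ := by
  rw [or_iff_not_imp_left]
  intro hpair
  push Not at hpair
  have hc : ∀ A ∈ ℬ, #A = q := fun A hA => (mem_powersetCard.1 (hℬ hA)).2
  have hV : ∀ A ∈ ℬ, A ⊆ V := fun A hA => (mem_powersetCard.1 (hℬ hA)).1
  obtain ⟨A, hA⟩ := hne
  obtain ⟨S₀, hS₀A, hS₀c⟩ := exists_subset_card_eq (s := A) (n := q - 1) (by rw [hc A hA]; omega)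
  obtain ⟨B, hB, hS₀B⟩ := h S₀ (by omega)
  have hne : A ≠ B := fun h => hS₀B (h ▸ hS₀A)
  have hAB : #(A ∩ B) + 1 = q := by
    refine le_antisymm ?_ (Nat.le_of_lt_succ (hpair A hA B hB))
    rw [Nat.succ_le_iff, ← hc A hA]
    exact card_lt_card (inter_subset_left.ssubset_of_ne fun h =>
      hne (eq_of_subset_of_card_le (inter_eq_left.1 h) (by rw [hc A hA, hc B hB])))
  obtain ⟨C, hC, hABC⟩ := h (A ∩ B) hAB
  exact ⟨A ∪ B, union_subset (hV A hA) (hV B hB), exists_erase_mem_of_not_inter_subset hc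
    (fun A hA B hB => Nat.le_of_lt_succ (hpair A hA B hB)) hA hB hC hAB hABC⟩

end Estimates

section Binomials

variable {k m : ℕ}

theorem choose_le_choose_of_add_le : ∀ {a b i : ℕ}, i ≤ b → i + b ≤ a → a.choose i ≤ a.choose b
  | a, b, 0, _, h => (Nat.choose_zero_right a).trans_le <| Nat.choose_pos (by omega)
  | 0, b + 1, i + 1, _, h => by omega
  | a + 1, b + 1, i + 1, hib, h => by
    obtain heq | hlt := h.eq_or_lt
    · rw [Nat.choose_symm_of_eq_add heq.symm]
    · rw [Nat.choose_succ_succ', Nat.choose_succ_succ']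
      exact Nat.add_le_add (choose_le_choose_of_add_le (by omega) (by omega))
        (choose_le_choose_of_add_le hib (by omega))

theorem two_mul_choose_two (a : ℕ) : 2 * (a + 1).choose 2 = (a + 1) * a := by
  rw [Nat.choose_two_right, Nat.mul_div_cancel' (Nat.even_mul_pred_self (a + 1)).two_dvd,
    Nat.add_sub_cancel]

theorem two_mul_le_choose {a b : ℕ} (hm : 5 ≤ m) (hma : m ≤ a) (hb : 2 ≤ b) (hba : b + 2 ≤ a) :
    2 * m ≤ a.choose b := by
  obtain ⟨c, rfl⟩ := Nat.exists_eq_add_of_le' (by omega : 1 ≤ m)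
  have hquad := two_mul_choose_two c
  calc 2 * (c + 1) ≤ (c + 1).choose 2 := by nlinarith
    _ ≤ a.choose 2 := Nat.choose_le_choose 2 hma
    _ ≤ a.choose b := choose_le_choose_of_add_le hb (by omega)

theorem three_mul_lt_choose (hk : 5 ≤ k) (hm : k ≤ m) : 3 * m < (m + k - 2).choose (k - 2) := by
  have hquad := two_mul_choose_two (m + 2)
  calc 3 * m < (m + 2 + 1).choose 2 := by nlinarith
    _ ≤ (m + k - 2).choose 2 := Nat.choose_le_choose 2 (by omega)
    _ ≤ (m + k - 2).choose (k - 2) := choose_le_choose_of_add_le (by omega) (by omega)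

theorem deficitJ_add_three_mul_le (hk : 5 ≤ k) (hm : k ≤ m) :
    deficitJ m (k - 1) + 3 * m ≤ m.choose (k - 2) + (m + 1).choose (k - 1) := by
  obtain ⟨b, rfl⟩ := Nat.exists_eq_add_of_le' (by omega : 3 ≤ k)
  obtain ⟨a, rfl⟩ := Nat.exists_eq_add_of_le' (by omega : 2 ≤ m)
  have hpascal₁ : (a + 2 + 1).choose (b + 2) = (a + 2).choose (b + 1) + (a + 2).choose (b + 2) :=
    Nat.choose_succ_succ' ..
  have hpascal₂ : (a + 2).choose (b + 1) = (a + 1).choose b + (a + 1).choose (b + 1) :=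
    Nat.choose_succ_succ' ..
  have hpascal₃ := Nat.choose_succ_succ' a b
  have hquad : (a + 1).choose 2 ≤ (a + 1).choose b :=
    choose_le_choose_of_add_le (by omega) (by omega)
  have hlin : a.choose 1 ≤ a.choose b := choose_le_choose_of_add_le (by omega) (by omega)
  have harith : 3 * (a + 2) ≤ (a + 1) * a + a := by nlinarith
  rw [← two_mul_choose_two] at harith
  rw [Nat.choose_one_right] at hlin
  change (a + 2).choose (b + 2) + (a + 1).choose (b + 1) + a.choose (b + 1) + 3 * (a + 2) ≤
    (a + 2).choose (b + 1) + (a + 2 + 1).choose (b + 2)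
  omega

theorem deficitJ_add_one_le (hk : 3 ≤ k) (hm : k ≤ m) :
    deficitJ m (k - 1) + 1 ≤ m.choose (k - 1) + 2 * (m - 1).choose (k - 2) := by
  obtain ⟨b, rfl⟩ := Nat.exists_eq_add_of_le' hk
  obtain ⟨a, rfl⟩ := Nat.exists_eq_add_of_le' (by omega : 2 ≤ m)
  have hpascal := Nat.choose_succ_succ' a b
  have hpos : 0 < a.choose b := Nat.choose_pos (by omega)
  change (a + 2).choose (b + 2) + (a + 1).choose (b + 1) + a.choose (b + 1) + 1 ≤
    (a + 2).choose (b + 2) + 2 * (a + 1).choose (b + 1)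
  omega

end Binomials

section CrossIntersecting

variable {α : Type*} {V : Finset α} {𝒜 ℬ : Finset (Finset α)} {p q : ℕ}

theorem card_add_card_blocked_le_choose [DecidableEq α] (h𝒜 : 𝒜 ⊆ V.powersetCard p)
    (h : ∀ X ∈ 𝒜, ∀ B ∈ ℬ, ¬Disjoint X B) : #𝒜 + #(blocked V p ℬ) ≤ (#V).choose p := by
  have hdisj : Disjoint 𝒜 (blocked V p ℬ) := disjoint_left.2 fun X hX hXb =>
    have ⟨_, B, hB, hXB⟩ := mem_blocked.1 hXb
    h X hX B hB hXB
  rw [← card_union_of_disjoint hdisj, ← card_powersetCard]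
  exact card_le_card (union_subset h𝒜 blocked_subset_powersetCard)

theorem card_le_choose_of_card_le (h𝒜 : 𝒜 ⊆ V.powersetCard q) (hℬ : ℬ ⊆ V.powersetCard q)
    (h : ∀ X ∈ 𝒜, ∀ B ∈ ℬ, ¬Disjoint X B) (hle : #ℬ ≤ #𝒜) (hq : 1 ≤ q) (hV : q + q ≤ #V) :
    #ℬ ≤ (#V - 1).choose (q - 1) := by
  classical
  by_contra! hlt
  have hblocked := choose_le_card_blocked hℬ hV hq hlt.le
  have hcard := card_add_card_blocked_le_choose h𝒜 h
  have hpascal := Nat.choose_succ_succ' (#V - 1) (q - 1)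
  rw [Nat.sub_add_cancel (by omega), Nat.sub_add_cancel hq] at hpascal
  omega

end CrossIntersecting

section Families

variable {n k m x i j : ℕ} {A U W : Finset ℕ} {F : Finset (Finset ℕ)}

/-- Some `k - 1` elements lie in all members of `F` that avoid a suitable point `x`.  These are
the subfamilies of the copies of `E_l`. -/
def IsNearStar (n k : ℕ) (F : Finset (Finset ℕ)) : Prop :=
  ∃ x ∈ ground n, ∃ S : Finset ℕ, #S + 1 = k ∧ ∀ A ∈ avoiding x F, S ⊆ A

theorem mem_ground : x ∈ ground n ↔ 1 ≤ x ∧ x ≤ n :=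
  mem_Icc

theorem card_ground (n : ℕ) : #(ground n) = n := by
  simp [ground]

theorem mem_interval : x ∈ interval k i ↔ i + 1 ≤ x ∧ x ≤ k + i :=
  mem_Icc

theorem card_interval (k i : ℕ) : #(interval k i) = k := by
  simp [interval]

theorem mem_avoiding : A ∈ avoiding x F ↔ A ∈ F ∧ x ∉ A :=
  mem_filter

theorem avoiding_eq_slice (x : ℕ) (F : Finset (Finset ℕ)) : avoiding x F = slice ∅ {x} F := by
  simp [avoiding, slice]

theorem link_empty_singleton (x : ℕ) (F : Finset (Finset ℕ)) : link ∅ {x} F = avoiding x F := by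
  simp [link, avoiding_eq_slice]

theorem IsIntersectingFamily.not_disjoint_of_mem_link (hF : IsIntersectingFamily n k F) :
    ∀ X ∈ link U W F, ∀ B ∈ link W U F, ¬Disjoint X B := by
  intro X hX B hB hXB
  obtain ⟨-, hUXW, hX⟩ := mem_link.1 hX
  obtain ⟨-, hWBU, hB⟩ := mem_link.1 hB
  refine not_disjoint_iff_nonempty_inter.2 (hF.2 _ hX _ hB) ?_
  simp only [disjoint_union_left, disjoint_union_right] at hUXW hWBU ⊢
  exact ⟨⟨hUXW.1, hUXW.2⟩, hWBU.2.symm, hXB⟩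

theorem IsIntersectingFamily.avoiding_subset (hF : IsIntersectingFamily n k F) :
    avoiding x F ⊆ (ground n \ {x}).powersetCard k := by
  have := link_subset_powersetCard (U := ∅) (W := {x}) hF.1
  rwa [link_empty_singleton, empty_union] at this

theorem IsIntersectingFamily.card_add_card_blocked_le (hF : IsIntersectingFamily n k F)
    (hx : x ∈ ground n) :
    #F + #(blocked (ground n \ {x}) (k - 1) (avoiding x F)) ≤
      (n - 1).choose (k - 1) + #(avoiding x F) := by
  have hsplit := card_slice_insert_add_card_slice_insert ∅ ∅ F x
  have hlink := link_subset_powersetCard (U := {x}) (W := ∅) hF.1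
  have hcross := card_add_card_blocked_le_choose hlink hF.not_disjoint_of_mem_link
  rw [card_link, link_empty_singleton, union_empty, card_singleton,
    card_sdiff_of_subset (singleton_subset_iff.2 hx), card_ground, card_singleton] at hcross
  rw [slice_empty_empty, insert_empty_eq, ← avoiding_eq_slice] at hsplit
  omega

theorem slice_subset_filter_union_slice (k : ℕ) (𝒢 : Finset (Finset ℕ)) :
    slice {1} ∅ 𝒢 ⊆
      {A ∈ 𝒢 | 1 ∈ A ∧ (A ∩ interval k 1).Nonempty ∧ (A ∩ interval k 3).Nonempty} ∪
        (slice {1} (interval k 1) 𝒢 ∪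
          (slice {1, 2} (interval k 3) 𝒢 ∪ slice {1, 3} (insert 2 (interval k 3)) 𝒢)) := by
  intro A hA
  obtain ⟨hA, h1A, -⟩ := mem_slice.1 hA
  rw [singleton_subset_iff] at h1A
  simp only [mem_union, mem_slice, mem_filter, hA, h1A, true_and, insert_subset_iff,
    singleton_subset_iff, disjoint_insert_right, ← not_disjoint_iff_nonempty_inter]
  by_cases h₁ : Disjoint A (interval k 1)
  · exact Or.inr (Or.inl h₁)
  by_cases h₃ : Disjoint A (interval k 3)
  · obtain ⟨y, hyA, hy₁⟩ := not_disjoint_iff.1 h₁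
    have hy₃ := disjoint_left.1 h₃ hyA
    rw [mem_interval] at hy₁ hy₃
    obtain rfl | rfl : y = 2 ∨ y = 3 := by omega
    · exact Or.inr (Or.inr (Or.inl ⟨hyA, h₃⟩))
    · by_cases h2A : 2 ∈ A
      · exact Or.inr (Or.inr (Or.inl ⟨h2A, h₃⟩))
      · exact Or.inr (Or.inr (Or.inr ⟨hyA, h2A, h₃⟩))
  · exact Or.inl ⟨h₁, h₃⟩

theorem interval_subset_Icc (hi : i ≤ 3) : interval k i ⊆ Icc 1 (k + 3) :=
  Icc_subset_Icc (by omega) (by omega)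

theorem card_slice_ground_powersetCard (hm : 2 ≤ m) (hU : U ⊆ Icc 1 (k + 3))
    (hW : W ⊆ Icc 1 (k + 3)) (hUW : Disjoint U W) (hk : #U ≤ k) :
    #(slice U W ((ground (m + k + 1)).powersetCard k)) =
      (m + k + 1 - #U - #W).choose (k - #U) := by
  have hground : Icc 1 (k + 3) ⊆ ground (m + k + 1) := Icc_subset_Icc_right (by omega)
  rw [card_slice_powersetCard (hU.trans hground) (hW.trans hground) hUW hk, card_ground]

theorem choose_le_card_filter_add_deficitJ (hk : 2 ≤ k) (hm : 2 ≤ m) :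
    (m + k).choose (k - 1) ≤ #{A ∈ (ground (m + k + 1)).powersetCard k |
      1 ∈ A ∧ (A ∩ interval k 1).Nonempty ∧ (A ∩ interval k 3).Nonempty} + deficitJ m (k - 1) := by
  have hstar := card_slice_ground_powersetCard (k := k) hm (U := {1}) (W := ∅) (by simp) (by simp)
    (by simp) (by simp; omega)
  have hslice₁ := card_slice_ground_powersetCard hm (U := {1}) (by simp)
    (interval_subset_Icc (k := k) (i := 1) (by simp)) (by simp [mem_interval]) (by simp; omega)
  have hslice₂ := card_slice_ground_powersetCard hm (U := {1, 2}) (by simp [insert_subset_iff])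
    (interval_subset_Icc (k := k) le_rfl) (by simp [mem_interval]) hk
  have hslice₃ := card_slice_ground_powersetCard hm (U := {1, 3}) (W := insert 2 (interval k 3))
    (by simp [insert_subset_iff]) (insert_subset (by simp) (interval_subset_Icc le_rfl))
    (by simp [mem_interval]) hk
  rw [card_singleton, card_empty, show m + k + 1 - 1 - 0 = m + k by omega] at hstar
  rw [card_singleton, card_interval, show m + k + 1 - 1 - k = m by omega] at hslice₁
  rw [card_pair (by decide : (1 : ℕ) ≠ 2), card_interval,
    show m + k + 1 - 2 - k = m - 1 by omega] at hslice₂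
  rw [card_pair (by decide : (1 : ℕ) ≠ 3), card_insert_of_notMem (by simp [mem_interval]),
    card_interval, show m + k + 1 - 2 - (k + 1) = m - 2 by omega] at hslice₃
  have hunion := (card_le_card (slice_subset_filter_union_slice k
    ((ground (m + k + 1)).powersetCard k))).trans <| (card_union_le _ _).trans <|
    Nat.add_le_add_left ((card_union_le _ _).trans <|
      Nat.add_le_add_left (card_union_le _ _) _) _
  rw [hstar, hslice₁, hslice₂, hslice₃] at hunion
  rw [deficitJ, show k - 1 - 1 = k - 2 by omega]
  omega

theorem choose_add_two_le_card_familyJ (hk : 2 ≤ k) (hm : 2 ≤ m) :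
    (m + k).choose (k - 1) + 2 ≤ #(familyJ (m + k + 1) k 3) + deficitJ m (k - 1) := by
  have hne : interval k 1 ≠ interval k 3 := fun h => by
    have := h ▸ (mem_interval (k := k) (i := 1) (x := 2)).2 (by omega)
    simp [mem_interval] at this
  have hcard := choose_le_card_filter_add_deficitJ hk hm
  rw [familyJ, card_union_of_disjoint (by simp [mem_interval]), card_pair hne]
  omega

theorem IsIntersectingFamily.card_le_card_familyJ_of_card_avoiding_add_le
    (hF : IsIntersectingFamily (m + k + 1) k F) (hk : 2 ≤ k) (hm : 2 ≤ m)
    (hx : x ∈ ground (m + k + 1))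
    (h : #(avoiding x F) + deficitJ m (k - 1) ≤
      #(blocked (ground (m + k + 1) \ {x}) (k - 1) (avoiding x F)) + 2) :
    #F ≤ #(familyJ (m + k + 1) k 3) := by
  have hcard := hF.card_add_card_blocked_le hx
  have hJ := choose_add_two_le_card_familyJ hk hm
  rw [Nat.add_sub_cancel] at hcard
  omega

theorem IsIntersectingFamily.card_le_card_familyJ_of_card_avoiding_le_two_mul
    (hF : IsIntersectingFamily (m + k + 1) k F) (hk : 5 ≤ k) (hm : k ≤ m)
    (hx : x ∈ ground (m + k + 1)) (hFstar : ¬IsNearStar (m + k + 1) k F)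
    (h : #(avoiding x F) ≤ 2 * m) : #F ≤ #(familyJ (m + k + 1) k 3) := by
  refine hF.card_le_card_familyJ_of_card_avoiding_add_le (by omega) (by omega) hx ?_
  have hV : #(ground (m + k + 1) \ {x}) = m + k := by
    rw [card_sdiff_of_subset (singleton_subset_iff.2 hx), card_ground, card_singleton]
    omega
  have hcard₁ : #(avoiding x F) ≤ (m + (k - 1) - 2).choose (k - 1 - 1) :=
    h.trans (two_mul_le_choose (by omega) (by omega) (by omega) (by omega))
  have hcard₂ : #(avoiding x F) ≤ (m + (k - 1) - 4).choose (k - 1 - 2) :=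
    h.trans (two_mul_le_choose (by omega) (by omega) (by omega) (by omega))
  have hstar : ∀ S : Finset ℕ, #S + 1 = k → ∃ B ∈ avoiding x F, ¬S ⊆ B := by
    intro S hS
    by_contra! hSB
    exact hFstar ⟨x, hx, S, hS, hSB⟩
  have hne : (avoiding x F).Nonempty := by
    obtain ⟨B, hB, -⟩ := hstar (range (k - 1)) (by rw [card_range]; omega)
    exact ⟨B, hB⟩
  obtain ⟨A, hA, B, hB, hAB⟩ | ⟨D, hD, S, hSD, hS, herase⟩ :=
    exists_card_inter_or_exists_erase_mem hF.avoiding_subset (by omega) hne hstar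
  · exact card_add_deficitJ_le_of_card_inter_add_two_le hF.avoiding_subset hV (by omega)
      (by omega) hcard₁ hcard₂ hA hB hAB
  · have hle := card_add_le_of_erase_mem (p := k - 1) hF.avoiding_subset hV (by omega) (by omega)
      hD hSD hS herase (excess_le_excess_of_subset (empty_subset _) fun i hi W' _ hW' _ =>
        excess_nonpos_of_card_le hF.avoiding_subset
          (singleton_subset_iff.2 (hD (mem_sdiff.1 hi).1)) (hW'.trans (sdiff_subset.trans hD))
          (by omega) (by simp; omega)
          (hcard₁.trans_eq (by rw [insert_empty_eq, card_singleton]; congr 1; omega)))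
    have hdeficit := deficitJ_add_one_le (by omega) hm
    rw [show k - 1 - 1 = k - 2 by omega] at hle
    omega

theorem IsIntersectingFamily.card_le_card_familyJ_of_card_avoiding_le
    (hF : IsIntersectingFamily (m + k + 1) k F) (hk : 5 ≤ k) (hm : k ≤ m)
    (hx : x ∈ ground (m + k + 1)) (hFstar : ¬IsNearStar (m + k + 1) k F)
    (h : #(avoiding x F) ≤ (m + k - 2).choose (k - 2)) : #F ≤ #(familyJ (m + k + 1) k 3) := by
  by_cases hsmall : #(avoiding x F) ≤ 2 * m
  · exact hF.card_le_card_familyJ_of_card_avoiding_le_two_mul hk hm hx hFstar hsmall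
  have hV : #(ground (m + k + 1) \ {x}) = m + k := by
    rw [card_sdiff_of_subset (singleton_subset_iff.2 hx), card_ground, card_singleton]
    omega
  have hle := card_add_le_of_two_mul_lt_card (p := k - 1) hF.avoiding_subset hV (by omega)
    (by omega) (j := 2) (by omega) (by omega) h (by omega)
  have hdeficit := deficitJ_add_three_mul_le hk hm
  rw [show k - 1 - 1 = k - 2 by omega] at hle
  exact hF.card_le_card_familyJ_of_card_avoiding_add_le (by omega) (by omega) hx (by omega)

theorem IsIntersectingFamily.card_le_card_familyJ_of_card_slice_le_card_slice
    (hF : IsIntersectingFamily (m + k + 1) k F) (hk : 5 ≤ k) (hm : k ≤ m)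
    (hi : i ∈ ground (m + k + 1)) (hj : j ∈ ground (m + k + 1)) (hij : i ≠ j)
    (hN : #(slice ∅ {i, j} F) ≤ m + 1) (hdiv : (m + k - 2).choose (k - 2) < #(avoiding i F))
    (hle : #(slice {j} {i} F) ≤ #(slice {i} {j} F)) : #F ≤ #(familyJ (m + k + 1) k 3) := by
  have hij' : {i, j} ⊆ ground (m + k + 1) := by simp [insert_subset_iff, hi, hj]
  have hV : #(ground (m + k + 1) \ {i, j}) = m + (k - 1) := by
    rw [card_sdiff_of_subset hij', card_ground, card_pair hij]
    omega
  have hlink : ∀ {U W}, U ∪ W = {i, j} →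
      link U W F ⊆ (ground (m + k + 1) \ {i, j}).powersetCard (k - #U) := fun hUW =>
    hUW ▸ link_subset_powersetCard hF.1
  have hP : link {i} {j} F ⊆ (ground (m + k + 1) \ {i, j}).powersetCard (k - 1) := hlink rfl
  have hQ : link {j} {i} F ⊆ (ground (m + k + 1) \ {i, j}).powersetCard (k - 1) :=
    hlink (pair_comm j i)
  have hR := card_le_card (hlink (U := {i, j}) (W := ∅) (union_empty _))
  have hPQ := card_add_card_blocked_le_choose hP hF.not_disjoint_of_mem_link
  have hQle := card_le_choose_of_card_le hP hQ hF.not_disjoint_of_mem_link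
    (by rwa [card_link, card_link]) (by omega) (by omega)
  rw [card_link] at hPQ hQle
  rw [card_link, card_powersetCard, card_pair hij] at hR
  have hsplit := card_slice_insert_add_card_slice_insert ∅ ∅ F i
  have hsplit₁ := card_slice_insert_add_card_slice_insert {i} ∅ F j
  have hsplit₀ := card_slice_insert_add_card_slice_insert ∅ {i} F j
  simp only [slice_empty_empty, insert_empty_eq, ← avoiding_eq_slice] at hsplit hsplit₁ hsplit₀
  rw [pair_comm j i] at hsplit₁ hsplit₀
  have hthree := three_mul_lt_choose hk hm
  have hblocked := card_add_le_of_two_mul_lt_card (p := k - 1) (j := 1) hQ hV (by omega) (by omega)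
    (by omega) (by omega) (by rw [card_link, ← hV]; exact hQle) (by rw [card_link]; omega)
  rw [card_link] at hblocked
  have hdeficit := deficitJ_add_three_mul_le hk hm
  have hJ := choose_add_two_le_card_familyJ (k := k) (m := m) (by omega) (by omega)
  have hpascal := Nat.choose_succ_succ' (m + (k - 1)) (k - 2)
  rw [show m + (k - 1) + 1 = m + k by omega, show k - 2 + 1 = k - 1 by omega] at hpascal
  rw [hV] at hR hPQ
  rw [show k - 1 - 1 = k - 2 by omega] at hblocked
  omega

theorem IsIntersectingFamily.card_le_card_familyJ_of_card_slice_le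
    (hF : IsIntersectingFamily (m + k + 1) k F) (hk : 5 ≤ k) (hm : k ≤ m)
    (hi : i ∈ ground (m + k + 1)) (hj : j ∈ ground (m + k + 1)) (hij : i ≠ j)
    (hN : #(slice ∅ {i, j} F) ≤ m + 1) (hdivi : (m + k - 2).choose (k - 2) < #(avoiding i F))
    (hdivj : (m + k - 2).choose (k - 2) < #(avoiding j F)) :
    #F ≤ #(familyJ (m + k + 1) k 3) := by
  obtain hle | hle := le_total #(slice {j} {i} F) #(slice {i} {j} F)
  · exact hF.card_le_card_familyJ_of_card_slice_le_card_slice hk hm hi hj hij hN hdivi hle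
  · exact hF.card_le_card_familyJ_of_card_slice_le_card_slice hk hm hj hi hij.symm
      (pair_comm i j ▸ hN) hdivj hle

theorem IsIntersectingFamily.card_avoiding_le (hF : IsIntersectingFamily n k F)
    (hx : x ∈ ground n) {S : Finset ℕ} (hS : #S + 1 = k) (hSF : ∀ A ∈ avoiding x F, S ⊆ A) :
    #(avoiding x F) ≤ n - k := by
  obtain hempty | ⟨A, hA⟩ := (avoiding x F).eq_empty_or_nonempty
  · simp [hempty]
  have hSV : S ⊆ ground n \ {x} :=
    (hSF A hA).trans (mem_powersetCard.1 (hF.avoiding_subset hA)).1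
  calc #(avoiding x F) ≤ #(slice S ∅ ((ground n \ {x}).powersetCard k)) :=
        card_le_card fun B hB =>
          mem_slice.2 ⟨hF.avoiding_subset hB, hSF B hB, disjoint_empty_right B⟩
    _ = n - k := by
      rw [card_slice_powersetCard hSV (empty_subset _) (disjoint_empty_right _) (by omega),
        show k - #S = 1 by omega, Nat.choose_one_right,
        card_sdiff_of_subset (singleton_subset_iff.2 hx), card_ground, card_singleton, card_empty]
      omega

end Families

section Compression

theorem sum_compression {α M : Type*} [GeneralizedBooleanAlgebra α]
    [DecidableRel (Disjoint (α := α))] [DecidableLE α] [DecidableEq α] [AddCommMonoid M] (u v : α)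
    (s : Finset α) (f : α → M) :
    ∑ a ∈ 𝓒 u v s, f a =
      ∑ a ∈ s, f (if UV.compress u v a ∈ s then a else UV.compress u v a) := by
  rw [UV.compression, sum_union UV.compress_disjoint, filter_image, sum_image UV.compress_injOn,
    sum_filter, sum_filter, ← sum_add_distrib]
  refine sum_congr rfl fun a _ => ?_
  split_ifs <;> simp

theorem exists_compress_notMem_of_not_isCompressed {α : Type*} [GeneralizedBooleanAlgebra α]
    [DecidableRel (Disjoint (α := α))] [DecidableLE α] [DecidableEq α] {u v : α} {s : Finset α}
    (hs : ¬UV.IsCompressed u v s) : ∃ a ∈ s, UV.compress u v a ∉ s := by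
  by_contra! h
  exact hs (eq_of_superset_of_card_ge (fun a ha => UV.mem_compression.2 (Or.inl ⟨ha, h a ha⟩))
    (UV.card_compression u v s).le)

theorem sum_compression_lt {α M : Type*} [GeneralizedBooleanAlgebra α]
    [DecidableRel (Disjoint (α := α))] [DecidableLE α] [DecidableEq α] [AddCommMonoid M]
    [PartialOrder M] [IsOrderedCancelAddMonoid M] {u v : α} {s : Finset α} {f : α → M}
    (hf : ∀ a, UV.compress u v a ≠ a → f (UV.compress u v a) < f a)
    (hs : ¬UV.IsCompressed u v s) : ∑ a ∈ 𝓒 u v s, f a < ∑ a ∈ s, f a := by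
  have hle : ∀ a, f (UV.compress u v a) ≤ f a := fun a => by
    obtain h | h := eq_or_ne (UV.compress u v a) a
    · rw [h]
    · exact (hf a h).le
  obtain ⟨a, ha, hau⟩ := exists_compress_notMem_of_not_isCompressed hs
  rw [sum_compression]
  refine sum_lt_sum (fun b _ => ?_) ⟨a, ha, ?_⟩
  · split_ifs
    exacts [le_rfl, hle b]
  · rw [if_neg hau]
    exact hf a fun h => hau (h.symm ▸ ha)

variable {n k i j x : ℕ} {A : Finset ℕ} {F : Finset (Finset ℕ)}

theorem compress_singleton_of_mem (hiA : i ∉ A) (hjA : j ∈ A) :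
    UV.compress {i} {j} A = insert i (A.erase j) := by
  rw [UV.compress_of_disjoint_of_le (disjoint_singleton_left.2 hiA) (singleton_subset_iff.2 hjA),
    sup_eq_union, union_comm, ← insert_eq, sdiff_singleton_eq_erase,
    erase_insert_of_ne (ne_of_mem_of_not_mem hjA hiA).symm]

theorem compress_singleton_of_ne (h : UV.compress {i} {j} A ≠ A) : i ∉ A ∧ j ∈ A := by
  by_contra hA
  refine h (if_neg ?_)
  rwa [disjoint_singleton_left, singleton_subset_iff]

theorem sum_compress_singleton_lt (hij : i < j) (h : UV.compress {i} {j} A ≠ A) :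
    ∑ a ∈ UV.compress {i} {j} A, a < ∑ a ∈ A, a := by
  obtain ⟨hiA, hjA⟩ := compress_singleton_of_ne h
  rw [compress_singleton_of_mem hiA hjA, sum_insert fun h => hiA (mem_of_mem_erase h),
    ← add_sum_erase A (fun a => a) hjA]
  exact Nat.add_lt_add_right hij _

theorem IsIntersectingFamily.inter_nonempty_of_notMem_of_mem_compression
    (hF : IsIntersectingFamily n k F) {B : Finset ℕ} (hA : A ∈ F)
    (hAc : UV.compress {i} {j} A ∈ F) (hB : B ∈ 𝓒 {i} {j} F) (hBF : B ∉ F) :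
    (A ∩ B).Nonempty := by
  have hiB := singleton_subset_iff.1 (UV.le_of_mem_compression_of_notMem hB hBF)
  by_cases hiA : i ∈ A
  · exact ⟨i, mem_inter.2 ⟨hiA, hiB⟩⟩
  have hB' : (B ∪ {j}) \ {i} ∈ F := UV.sup_sdiff_mem_of_mem_compression_of_notMem hB hBF
  by_cases hjA : j ∈ A
  · rw [compress_singleton_of_mem hiA hjA] at hAc
    obtain ⟨y, hy⟩ := hF.2 _ hAc _ hB'
    refine ⟨y, ?_⟩
    simp only [mem_inter, mem_insert, mem_erase, mem_sdiff, mem_union, mem_singleton] at hy ⊢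
    tauto
  · obtain ⟨y, hy⟩ := hF.2 _ hA _ hB'
    refine ⟨y, ?_⟩
    simp only [mem_inter, mem_sdiff, mem_union, mem_singleton] at hy ⊢
    exact ⟨hy.1, hy.2.1.resolve_right fun h => hjA (h ▸ hy.1)⟩

theorem IsIntersectingFamily.compression (hF : IsIntersectingFamily n k F) (hi : i ∈ ground n) :
    IsIntersectingFamily n k (𝓒 {i} {j} F) := by
  refine ⟨fun A hA => ?_, fun A hA B hB => ?_⟩
  · obtain ⟨hA, -⟩ | ⟨hAF, B, hB, rfl⟩ := UV.mem_compression.1 hA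
    · exact hF.1 hA
    · obtain ⟨hiB, hjB⟩ := compress_singleton_of_ne (ne_of_mem_of_not_mem hB hAF).symm
      obtain ⟨hBn, hBk⟩ := mem_powersetCard.1 (hF.1 hB)
      rw [mem_powersetCard, UV.card_compress (by simp), compress_singleton_of_mem hiB hjB]
      exact ⟨insert_subset hi ((erase_subset _ _).trans hBn), hBk⟩
  · obtain ⟨hAF, hAc⟩ | ⟨hAF, -⟩ := UV.mem_compression.1 hA <;>
      obtain ⟨hBF, hBc⟩ | ⟨hBF, -⟩ := UV.mem_compression.1 hB
    · exact hF.2 A hAF B hBF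
    · exact hF.inter_nonempty_of_notMem_of_mem_compression hAF hAc hB hBF
    · rw [inter_comm]
      exact hF.inter_nonempty_of_notMem_of_mem_compression hBF hBc hA hAF
    · exact ⟨i, mem_inter.2
        ⟨singleton_subset_iff.1 (UV.le_of_mem_compression_of_notMem hA hAF),
          singleton_subset_iff.1 (UV.le_of_mem_compression_of_notMem hB hBF)⟩⟩

theorem card_avoiding_le_card_avoiding_compression (hxi : x ≠ i) :
    #(avoiding x F) ≤ #(avoiding x (𝓒 {i} {j} F)) := by
  rw [avoiding, avoiding, card_filter, card_filter, sum_compression]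
  refine sum_le_sum fun A _ => ?_
  have hmono : x ∉ A → x ∉ UV.compress {i} {j} A := fun hxA hxc => by
    obtain ⟨hiA, hjA⟩ := compress_singleton_of_ne (ne_of_mem_of_not_mem' hxc hxA)
    rw [compress_singleton_of_mem hiA hjA, mem_insert] at hxc
    exact hxc.elim hxi fun h => hxA (mem_of_mem_erase h)
  split_ifs <;> simp_all

theorem slice_subset_avoiding_compression (i j : ℕ) (F : Finset (Finset ℕ)) :
    slice ∅ {i, j} F ⊆ avoiding i (𝓒 {i} {j} F) := by
  intro A hA
  obtain ⟨hAF, -, hAij⟩ := mem_slice.1 hA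
  rw [disjoint_insert_right, disjoint_singleton_right] at hAij
  have hfix : UV.compress {i} {j} A = A := by
    by_contra h
    exact hAij.2 (compress_singleton_of_ne h).2
  exact mem_avoiding.2 ⟨UV.mem_compression.2 (Or.inl ⟨hAF, hfix.symm ▸ hAF⟩), hAij.1⟩

end Compression

section Shifting

variable {n k j r : ℕ} {B C U W : Finset ℕ} {F : Finset (Finset ℕ)}

/-- `F` is stable under replacing an element of a member by a smaller positive integer outside it.
In `UV.IsCompressed {i} {j} F` the element `j` is replaced by `i`. -/
def IsShifted (F : Finset (Finset ℕ)) : Prop :=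
  ∀ i j, 1 ≤ i → i < j → UV.IsCompressed {i} {j} F

theorem IsShifted.insert_erase_mem {i : ℕ} (hs : IsShifted F) (hi : 1 ≤ i) (hij : i < j)
    (hB : B ∈ F) (hiB : i ∉ B) (hjB : j ∈ B) : insert i (B.erase j) ∈ F := by
  rw [← compress_singleton_of_mem hiB hjB, ← (hs i j hi hij).eq]
  exact UV.compress_mem_compression hB

theorem card_insert_erase_inter_le {α : Type*} [DecidableEq α] {A D : Finset α} {a c : α}
    (ha : a ∈ A ∩ D) : #(insert c (A.erase a) ∩ D) ≤ #(A ∩ D) := by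
  rw [← card_erase_add_one ha]
  refine (card_le_card (fun y hy => ?_)).trans (card_insert_le c _)
  simp only [mem_inter, mem_insert, mem_erase] at hy ⊢
  tauto

theorem IsShifted.exists_subset_of_card_inter_Icc_le (hs : IsShifted F) (hB : B ∈ F) (h0 : 0 ∉ B)
    (hC : ∀ b ∈ B, #(B ∩ Icc 1 b) ≤ #(C ∩ Icc 1 b)) : ∃ A ∈ F, A ⊆ C := by
  induction hd : #(B \ C) using Nat.strong_induction_on generalizing B with
  | _ d ih =>
    obtain hempty | hne := (B \ C).eq_empty_or_nonempty
    · exact ⟨B, hB, sdiff_eq_empty_iff_subset.1 hempty⟩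
    obtain ⟨b, hb, hmin⟩ := exists_min_image (B \ C) id hne
    have hsub : ∀ a ∈ B, a < b → a ∈ C := fun a haB hab => by
      by_contra haC
      exact hab.not_ge (hmin a (mem_sdiff.2 ⟨haB, haC⟩))
    obtain ⟨hbB, hbC⟩ := mem_sdiff.1 hb
    have hb1 : 1 ≤ b := Nat.one_le_iff_ne_zero.2 (ne_of_mem_of_not_mem hbB h0)
    obtain ⟨c, hcC, hcB⟩ := exists_mem_notMem_of_card_lt_card <|
      (card_erase_lt_of_mem (mem_inter.2 ⟨hbB, mem_Icc.2 ⟨hb1, le_rfl⟩⟩)).trans_le (hC b hbB)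
    obtain ⟨hcC, hcIcc⟩ := mem_inter.1 hcC
    have hcb : c ≠ b := ne_of_mem_of_not_mem hcC hbC
    have hcB : c ∉ B := fun h => hcB (mem_erase.2 ⟨hcb, mem_inter.2 ⟨h, hcIcc⟩⟩)
    obtain ⟨hc, hcb'⟩ := mem_Icc.1 hcIcc
    have hsdiff : insert c (B.erase b) \ C ⊆ (B \ C).erase b := by
      rw [insert_sdiff_of_mem _ hcC, erase_sdiff_comm]
    refine ih _ (hd ▸ (card_le_card hsdiff).trans_lt (card_erase_lt_of_mem hb))
      (hs.insert_erase_mem hc (hcb'.lt_of_ne hcb) hB hcB hbB) ?_ (fun a ha => ?_) rfl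
    · simp only [mem_insert, mem_erase, h0, and_false, or_false]
      omega
    · by_cases hab : a < b
      · refine card_le_card fun y hy => ?_
        simp only [mem_inter, mem_insert, mem_erase, mem_Icc] at hy ⊢
        obtain ⟨rfl | ⟨-, hyB⟩, hy, hya⟩ := hy
        · exact ⟨hcC, hy, hya⟩
        · exact ⟨hsub y hyB (by omega), hy, hya⟩
      · rw [mem_insert, mem_erase] at ha
        exact (card_insert_erase_inter_le
          (mem_inter.2 ⟨hbB, mem_Icc.2 ⟨hb1, not_lt.1 hab⟩⟩)).trans
          (hC a (ha.resolve_left (by omega)).2)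

theorem IsIntersectingFamily.mem_ground_of_mem (hF : IsIntersectingFamily n k F) (hB : B ∈ F)
    (hj : j ∈ B) : j ∈ ground n :=
  (mem_powersetCard.1 (hF.1 hB)).1 hj

theorem IsIntersectingFamily.zero_notMem (hF : IsIntersectingFamily n k F) (hB : B ∈ F) : 0 ∉ B :=
  fun h => by simpa using mem_ground.1 (hF.mem_ground_of_mem hB h)

/-- The ballot condition: no initial segment `[1, m]` has more than half of its elements in `W`. -/
def IsBallot (W : Finset ℕ) : Prop :=
  ∀ m, 2 * #(W ∩ Icc 1 m) ≤ m

theorem isBallot_empty : IsBallot ∅ := fun m => by simp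

theorem IsBallot.mono (hW : IsBallot W) (hBW : B ⊆ W) : IsBallot B := fun m =>
  (Nat.mul_le_mul_left 2 (card_le_card (inter_subset_inter_right hBW))).trans (hW m)

theorem IsBallot.insert_of_two_mul_le (hW : IsBallot W) (h : 2 * (#W + 1) ≤ r) :
    IsBallot (insert r W) := by
  intro m
  obtain hm | hm := lt_or_ge m r
  · rw [insert_inter_of_notMem (by rw [mem_Icc]; omega)]
    exact hW m
  · have := card_le_card (inter_subset_left (s₁ := insert r W) (s₂ := Icc 1 m))
    have := card_insert_le r W
    omega

theorem IsShifted.not_isBallot (hs : IsShifted F) (hF : IsIntersectingFamily n k F) (hB : B ∈ F) :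
    ¬IsBallot B := by
  intro h
  obtain ⟨A, hA, hAB⟩ := hs.exists_subset_of_card_inter_Icc_le hB (hF.zero_notMem hB)
    (C := ground n \ B) fun b hb => by
      have hIcc : Icc 1 b ⊆ ground n :=
        Icc_subset_Icc_right (mem_ground.1 (hF.mem_ground_of_mem hB hb)).2
      have hcard := card_sdiff_add_card_inter (Icc 1 b) B
      rw [Nat.card_Icc, inter_comm] at hcard
      have := h b
      rw [inter_comm (_ \ _), ← inter_sdiff_assoc, inter_eq_left.2 hIcc]
      omega
  exact not_disjoint_iff_nonempty_inter.2 (hF.2 A hA B hB)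
    (disjoint_of_subset_left hAB sdiff_disjoint)

theorem card_inter_Icc_le_card_erase_inter_Icc {s : ℕ} (h1 : 1 ∉ B) (hBk : #B = k)
    (hsk : s ∈ Icc 2 k) (hsB : s ∉ B) (hj : j ∈ Icc k (k + 2)) (b : ℕ) :
    #(B ∩ Icc 1 b) ≤ #((Icc 2 (k + 2)).erase j ∩ Icc 1 b) := by
  rw [mem_Icc] at hsk hj
  have hBs : B ∩ Icc 1 b ⊆ (Icc 2 b).erase s := fun y hy => by
    obtain ⟨hyB, hy⟩ := mem_inter.1 hy
    have hy1 := ne_of_mem_of_not_mem hyB h1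
    rw [mem_Icc] at hy
    exact mem_erase.2 ⟨ne_of_mem_of_not_mem hyB hsB, mem_Icc.2 (by omega)⟩
  obtain hb | hb := le_or_gt b (k + 2)
  · calc #(B ∩ Icc 1 b) ≤ #((Icc 2 b).erase s) := card_le_card hBs
      _ ≤ #((Icc 2 b).erase j) := by
        obtain hbk | hbk := lt_or_ge b k
        · rw [erase_eq_of_notMem (s := Icc 2 b) (a := j) (by rw [mem_Icc]; omega)]
          exact card_erase_le
        · rw [card_erase_of_mem (mem_Icc.2 (by omega))]
          exact pred_card_le_card_erase
      _ ≤ #((Icc 2 (k + 2)).erase j ∩ Icc 1 b) := by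
        refine card_le_card (subset_inter (erase_subset_erase j (Icc_subset_Icc_right hb)) ?_)
        exact (erase_subset _ _).trans (Icc_subset_Icc_left (by omega))
  · calc #(B ∩ Icc 1 b) ≤ #B := card_le_card inter_subset_left
      _ = #((Icc 2 (k + 2)).erase j ∩ Icc 1 b) := by
        rw [inter_eq_left.2 ((erase_subset _ _).trans (Icc_subset_Icc (by omega) hb.le)),
          card_erase_of_mem (mem_Icc.2 (by omega)), Nat.card_Icc]
        omega

theorem IsShifted.erase_mem_of_not_isNearStar (hs : IsShifted F) (hF : IsIntersectingFamily n k F)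
    (hk : 2 ≤ k) (hn : 1 ≤ n) (hFstar : ¬IsNearStar n k F) (hj : j ∈ Icc k (k + 2)) :
    (Icc 2 (k + 2)).erase j ∈ F := by
  obtain ⟨B, hB, hBk⟩ : ∃ B ∈ avoiding 1 F, ¬Icc 2 k ⊆ B := by
    by_contra! h
    exact hFstar ⟨1, mem_ground.2 ⟨le_rfl, hn⟩, Icc 2 k, by rw [Nat.card_Icc]; omega, h⟩
  obtain ⟨s, hsk, hsB⟩ := not_subset.1 hBk
  obtain ⟨hBF, h1B⟩ := mem_avoiding.1 hB
  obtain ⟨A, hA, hAC⟩ := hs.exists_subset_of_card_inter_Icc_le hBF (hF.zero_notMem hBF) fun b _ =>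
    card_inter_Icc_le_card_erase_inter_Icc h1B (mem_powersetCard.1 (hF.1 hBF)).2 hsk hsB hj b
  rwa [← eq_of_subset_of_card_le hAC]
  rw [card_erase_of_mem (Icc_subset_Icc_left hk hj), Nat.card_Icc,
    (mem_powersetCard.1 (hF.1 hA)).2]
  omega

theorem ground_sdiff_one (n : ℕ) : ground n \ {1} = Icc 2 n := by
  ext
  rw [mem_sdiff, mem_ground, mem_singleton, mem_Icc]
  omega

theorem IsShifted.excess_avoiding_nonpos (hs : IsShifted F) (hF : IsIntersectingFamily n k F)
    (hk : 1 ≤ k) (hn : 2 * k ≤ n) (hr₁ : 1 ≤ r) (hr : r ≤ n) (hUW : U ∪ W = Icc 2 r)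
    (hdisj : Disjoint U W) (hW : IsBallot W) (hle : #W ≤ #U) :
    excess (ground n \ {1}) (k - 1) (avoiding 1 F) U W ≤ 0 := by
  induction hd : n - r generalizing r U W with
  | zero =>
    refine excess_nonpos_of_forall_not_disjoint fun B hB _ hBU =>
      hs.not_isBallot hF (mem_avoiding.1 hB).1 (hW.mono fun y hy => ?_)
    have hyV := (mem_powersetCard.1 (hF.avoiding_subset hB)).1 hy
    rw [ground_sdiff_one, show n = r by omega, ← hUW, mem_union] at hyV
    exact hyV.resolve_left (disjoint_left.1 hBU hy)
  | succ d ih =>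
    have hIcc : insert (r + 1) (Icc 2 r) = Icc 2 (r + 1) :=
      insert_Icc_right_eq_Icc_add_one (by omega)
    have hnew : r + 1 ∉ U ∪ W := by
      rw [hUW, mem_Icc]
      omega
    rw [mem_union, not_or] at hnew
    have hcard : #U + #W = r - 1 := by
      rw [← card_union_of_disjoint hdisj, hUW, Nat.card_Icc]
      omega
    rw [← excess_insert_add_excess_insert _ _ _ U W (r + 1)]
    refine add_nonpos ?_ ?_
    · refine ih (r := r + 1) (by omega) (by omega) (by rw [insert_union, hUW, hIcc])
        (disjoint_insert_left.2 ⟨hnew.2, hdisj⟩) hW ?_ (by omega)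
      exact hle.trans (card_le_card (subset_insert _ _))
    obtain hlt | hge := lt_or_ge #W #U
    · exact ih (r := r + 1) (by omega) (by omega) (by rw [union_insert, hUW, hIcc])
        (disjoint_insert_right.2 ⟨hnew.1, hdisj⟩) (hW.insert_of_two_mul_le (by omega))
        (by rwa [card_insert_of_notMem hnew.2]) (by omega)
    · have hsub : U ∪ insert (r + 1) W ⊆ ground n \ {1} := by
        rw [ground_sdiff_one, union_insert, hUW, hIcc]
        exact Icc_subset_Icc_right (by omega)
      refine excess_nonpos_of_card_add_le hF.avoiding_subset (union_subset_left hsub)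
        (union_subset_right hsub) ?_ ?_
      · rw [ground_sdiff_one, Nat.card_Icc]
        omega
      · rw [card_insert_of_notMem hnew.2]
        omega

theorem IsShifted.excess_avoiding_le_excess_Icc (hs : IsShifted F) (hF : IsIntersectingFamily n k F)
    (hk : 4 ≤ k) (hn : 2 * k ≤ n) :
    excess (ground n \ {1}) (k - 1) (avoiding 1 F) ∅ ∅ ≤
      excess (ground n \ {1}) (k - 1) (avoiding 1 F) ∅ (Icc 2 (k - 1)) := by
  have hU₂ := hs.excess_avoiding_nonpos hF (r := 2) (U := {2}) (W := ∅) (by omega) hn (by omega)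
    (by omega) rfl (by simp) isBallot_empty (by simp)
  have hU₃ := hs.excess_avoiding_nonpos hF (r := 3) (U := {3}) (W := {2}) (by omega) hn (by omega)
    (by omega) (by decide) (by simp) (isBallot_empty.insert_of_two_mul_le (by simp)) (by simp)
  have hsplit₂ := excess_insert_add_excess_insert (ground n \ {1}) (k - 1) (avoiding 1 F) ∅ ∅ 2
  have hsplit₃ := excess_insert_add_excess_insert (ground n \ {1}) (k - 1) (avoiding 1 F) ∅ {2} 3
  simp only [insert_empty_eq] at hsplit₂ hsplit₃
  have hsub : Icc 2 (k - 1) ⊆ ground n \ {1} := by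
    rw [ground_sdiff_one]
    exact Icc_subset_Icc_right (by omega)
  have hchain : excess (ground n \ {1}) (k - 1) (avoiding 1 F) ∅ {3, 2} ≤
      excess (ground n \ {1}) (k - 1) (avoiding 1 F) ∅ (Icc 2 (k - 1)) := by
    refine excess_le_excess_of_subset ?_ fun i hi W' hW hW' _ => ?_
    · simp only [insert_subset_iff, singleton_subset_iff, mem_Icc]
      omega
    · refine excess_nonpos_of_card_add_le hF.avoiding_subset
        (by simpa using hsub hi) (hW'.trans hsub) ?_ ?_
      · rw [ground_sdiff_one, Nat.card_Icc]
        omega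
      · have := card_le_card hW
        rw [card_pair (by decide)] at this
        rw [insert_empty_eq, card_singleton]
        omega
  linarith

theorem IsShifted.card_le_card_familyJ {m : ℕ} (hs : IsShifted F)
    (hF : IsIntersectingFamily (m + k + 1) k F) (hk : 5 ≤ k) (hm : k ≤ m)
    (hFstar : ¬IsNearStar (m + k + 1) k F) : #F ≤ #(familyJ (m + k + 1) k 3) := by
  refine hF.card_le_card_familyJ_of_card_avoiding_add_le (by omega) (by omega)
    (mem_ground.2 ⟨le_rfl, by omega⟩) ?_
  have hsdiff : Icc 2 (k + 2) \ Icc k (k + 2) = Icc 2 (k - 1) := by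
    ext
    simp only [mem_sdiff, mem_Icc]
    omega
  have hbound := card_add_le_of_erase_mem (m := m) (p := k - 1) (D := Icc 2 (k + 2))
    (S := Icc k (k + 2)) hF.avoiding_subset (V := ground (m + k + 1) \ {1})
    (by rw [ground_sdiff_one, Nat.card_Icc]; omega) (by omega) (by omega)
    (by rw [ground_sdiff_one]; exact Icc_subset_Icc_right (by omega))
    (Icc_subset_Icc_left (by omega)) (by rw [Nat.card_Icc]; omega)
    (fun j hj => mem_avoiding.2 ⟨hs.erase_mem_of_not_isNearStar hF (by omega) (by omega) hFstar
      hj, by simp⟩)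
    (hsdiff ▸ hs.excess_avoiding_le_excess_Icc hF (by omega) (by omega))
  have hdeficit := deficitJ_add_one_le (k := k) (by omega) hm
  rw [show k - 1 - 1 = k - 2 by omega] at hbound
  omega

end Shifting

section Reduction

variable {m k i j : ℕ} {F : Finset (Finset ℕ)}

theorem IsIntersectingFamily.card_le_card_familyJ_of_isNearStar_compression
    (hF : IsIntersectingFamily (m + k + 1) k F) (hk : 5 ≤ k) (hm : k ≤ m) (hij : i ≠ j)
    (hi : i ∈ ground (m + k + 1)) (hj : j ∈ ground (m + k + 1))
    (hFstar : ¬IsNearStar (m + k + 1) k F)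
    (hstar : IsNearStar (m + k + 1) k (𝓒 {i} {j} F)) : #F ≤ #(familyJ (m + k + 1) k 3) := by
  obtain ⟨x, hx, S, hS, hSF⟩ := hstar
  have hle : #(avoiding x (𝓒 {i} {j} F)) ≤ m + 1 := by
    have := (hF.compression (j := j) hi).card_avoiding_le hx hS hSF
    omega
  by_contra! hlt
  have hdiv : ∀ y ∈ ground (m + k + 1), (m + k - 2).choose (k - 2) < #(avoiding y F) :=
    fun y hy => by
      by_contra! h
      exact hlt.not_ge (hF.card_le_card_familyJ_of_card_avoiding_le hk hm hy hFstar h)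
  obtain rfl | hxi := eq_or_ne x i
  · exact hlt.not_ge <| hF.card_le_card_familyJ_of_card_slice_le hk hm hi hj hij
      ((card_le_card (slice_subset_avoiding_compression x j F)).trans hle) (hdiv x hi) (hdiv j hj)
  · have := card_avoiding_le_card_avoiding_compression (j := j) (F := F) hxi
    have := hdiv x hx
    have := three_mul_lt_choose hk hm
    omega

theorem IsIntersectingFamily.card_le_card_familyJ (hF : IsIntersectingFamily (m + k + 1) k F)
    (hk : 5 ≤ k) (hm : k ≤ m) (hFstar : ¬IsNearStar (m + k + 1) k F) :
    #F ≤ #(familyJ (m + k + 1) k 3) := by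
  induction hw : ∑ A ∈ F, ∑ a ∈ A, a using Nat.strong_induction_on generalizing F with
  | _ w ih =>
    by_cases hs : IsShifted F
    · exact hs.card_le_card_familyJ hF hk hm hFstar
    unfold IsShifted at hs
    push Not at hs
    obtain ⟨i, j, hi, hij, hcomp⟩ := hs
    obtain ⟨A, hA, hAc⟩ := exists_compress_notMem_of_not_isCompressed hcomp
    have hjA := (compress_singleton_of_ne (ne_of_mem_of_not_mem hA hAc).symm).2
    have hj : j ∈ ground (m + k + 1) := hF.mem_ground_of_mem hA hjA
    have hig : i ∈ ground (m + k + 1) := mem_ground.2 ⟨hi, hij.le.trans (mem_ground.1 hj).2⟩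
    by_cases hstar : IsNearStar (m + k + 1) k (𝓒 {i} {j} F)
    · exact hF.card_le_card_familyJ_of_isNearStar_compression hk hm hij.ne hig hj hFstar hstar
    have hdecr : ∑ A ∈ 𝓒 {i} {j} F, ∑ a ∈ A, a < ∑ A ∈ F, ∑ a ∈ A, a :=
      sum_compression_lt (fun A => sum_compress_singleton_lt hij) hcomp
    rw [← UV.card_compression {i} {j} F]
    exact ih _ (hw ▸ hdecr) (hF.compression hig) hstar rfl

end Reduction

section NearStar

variable {n k l x : ℕ} {A S : Finset ℕ} {F : Finset (Finset ℕ)}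

theorem IsIntersectingFamily.exists_isCopyOfE (hF : IsIntersectingFamily n k F)
    (hl : #(avoiding x F) = l) (hcommon : 2 ≤ l → #(commonIntersection n (avoiding x F)) = k - 1) :
    ∃ E, IsCopyOfE n k l x E ∧ F ⊆ E := by
  have hfin : {G | IsIntersectingFamily n k G ∧ #(avoiding x G) = l ∧
      (2 ≤ l → #(commonIntersection n (avoiding x G)) = k - 1)}.Finite :=
    (finite_toSet ((ground n).powersetCard k).powerset).subset fun G hG =>
      mem_coe.2 (mem_powerset.2 hG.1.1)
  obtain ⟨E, hFE, hE⟩ := hfin.exists_le_maximal ⟨hF, hl, hcommon⟩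
  exact ⟨E, hE, hFE⟩

theorem card_commonIntersection {M : Finset (Finset ℕ)} (hM : M ⊆ (ground n).powersetCard k)
    (hS : #S = k - 1) (hSM : ∀ A ∈ M, S ⊆ A) (hcard : 2 ≤ #M) :
    #(commonIntersection n M) = k - 1 := by
  obtain ⟨A, hA, B, hB, hAB⟩ := one_lt_card.1 hcard
  obtain ⟨hAn, hAk⟩ := mem_powersetCard.1 (hM hA)
  have hBk := (mem_powersetCard.1 (hM hB)).2
  refine le_antisymm ?_ ?_
  · have hlt : #(A ∩ B) < k := hAk ▸ card_lt_card
      (inter_subset_left.ssubset_of_ne fun h =>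
        hAB (eq_of_subset_of_card_le (inter_eq_left.1 h) (hBk.trans hAk.symm).le))
    have hsub : commonIntersection n M ⊆ A ∩ B := fun a ha =>
      have h := (mem_filter.1 ha).2
      mem_inter.2 ⟨h A hA, h B hB⟩
    exact Nat.le_sub_one_of_lt ((card_le_card hsub).trans_lt hlt)
  · rw [← hS]
    exact card_le_card fun a ha => mem_filter.2 ⟨hAn (hSM A hA ha), fun C hC => hSM C hC ha⟩

/-- The `k`-subsets of `[n]` that contain `S` and avoid `x`.  When `#S = k - 1`, these are the
members avoiding `x` of a copy of `E_{n-k}`. -/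
def petals (n k x : ℕ) (S : Finset ℕ) : Finset (Finset ℕ) :=
  slice S {x} ((ground n).powersetCard k)

theorem mem_petals : A ∈ petals n k x S ↔ A ∈ (ground n).powersetCard k ∧ S ⊆ A ∧ x ∉ A := by
  rw [petals, mem_slice, disjoint_singleton_right]

theorem card_petals (hS : #S + 1 = k) (hSn : S ⊆ ground n) (hx : x ∈ ground n) (hxS : x ∉ S) :
    #(petals n k x S) = n - k := by
  rw [petals, card_slice_powersetCard hSn (singleton_subset_iff.2 hx)
    (disjoint_singleton_right.2 hxS) (by omega), show k - #S = 1 by omega, Nat.choose_one_right,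
    card_ground, card_singleton]
  omega

theorem IsIntersectingFamily.not_disjoint_of_le_card_avoiding (hF : IsIntersectingFamily n k F)
    (hS : #S + 1 = k) (hSF : ∀ B ∈ avoiding x F, S ⊆ B) (hSne : S.Nonempty)
    (hcard : k ≤ #(avoiding x F)) (hA : A ∈ F) : ¬Disjoint A S := by
  intro hAS
  have hxA : x ∈ A := by
    by_contra hxA
    exact hSne.ne_empty (disjoint_self_iff_empty S |>.1
      (hAS.mono_left (hSF A (mem_avoiding.2 ⟨hA, hxA⟩))))
  -- `A` must contain the point outside `S` of each member avoiding `x`.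
  have hsub : avoiding x F ⊆ (A.erase x).image (insert · S) := fun B hB => by
    obtain ⟨hBF, hxB⟩ := mem_avoiding.1 hB
    obtain ⟨y, hy⟩ := hF.2 A hA B hBF
    obtain ⟨hyA, hyB⟩ := mem_inter.1 hy
    have hyS : y ∉ S := disjoint_left.1 hAS hyA
    have hBk := (mem_powersetCard.1 (hF.1 hBF)).2
    refine mem_image.2 ⟨y, mem_erase.2 ⟨ne_of_mem_of_not_mem hyB hxB, hyA⟩,
      eq_of_subset_of_card_le (insert_subset hyB (hSF B hB)) ?_⟩
    rw [card_insert_of_notMem hyS, hS, hBk]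
  have hle : #(avoiding x F) ≤ k - 1 :=
    (card_le_card hsub).trans <| card_image_le.trans_eq <| by
      rw [card_erase_of_mem hxA, (mem_powersetCard.1 (hF.1 hA)).2]
  omega

theorem IsIntersectingFamily.union_petals (hF : IsIntersectingFamily n k F) (hS : S.Nonempty)
    (hFS : ∀ A ∈ F, ¬Disjoint A S) : IsIntersectingFamily n k (F ∪ petals n k x S) := by
  have hmeet : ∀ A ∈ F ∪ petals n k x S, (A ∩ S).Nonempty := fun A hA => by
    obtain hA | hA := mem_union.1 hA
    · exact not_disjoint_iff_nonempty_inter.1 (hFS A hA)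
    · rwa [inter_eq_right.2 (mem_petals.1 hA).2.1]
  refine ⟨union_subset hF.1 (filter_subset _ _), fun A hA B hB => ?_⟩
  obtain hBF | hBp := mem_union.1 hB
  · obtain hAF | hAp := mem_union.1 hA
    · exact hF.2 A hAF B hBF
    · exact inter_comm A B ▸ (hmeet B hB).mono (inter_subset_inter_left (mem_petals.1 hAp).2.1)
  · exact (hmeet A hA).mono (inter_subset_inter_left (mem_petals.1 hBp).2.1)

theorem IsIntersectingFamily.avoiding_union_petals (hF : IsIntersectingFamily n k F)
    (hSF : ∀ A ∈ avoiding x F, S ⊆ A) : avoiding x (F ∪ petals n k x S) = petals n k x S := by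
  ext A
  rw [mem_avoiding, mem_union]
  refine ⟨?_, fun hA => ⟨Or.inr hA, (mem_petals.1 hA).2.2⟩⟩
  rintro ⟨hA | hA, hxA⟩
  · exact mem_petals.2 ⟨hF.1 hA, hSF A (mem_avoiding.2 ⟨hA, hxA⟩), hxA⟩
  · exact hA

theorem IsNearStar.exists_isCopyOfE (hstar : IsNearStar n k F) (hF : IsIntersectingFamily n k F)
    (hk : 2 ≤ k) :
    ∃ l, (l ≤ k - 1 ∨ l = n - k) ∧ ∃ x ∈ ground n, ∃ E, IsCopyOfE n k l x E ∧ F ⊆ E := by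
  obtain ⟨x, hx, S, hS, hSF⟩ := hstar
  have hSk : #S = k - 1 := by omega
  obtain hl | hl := le_or_gt #(avoiding x F) (k - 1)
  · exact ⟨_, Or.inl hl, x, hx, hF.exists_isCopyOfE rfl fun h =>
      card_commonIntersection ((filter_subset _ _).trans hF.1) hSk hSF h⟩
  obtain ⟨A, hA⟩ : (avoiding x F).Nonempty := card_pos.1 (by omega)
  obtain ⟨hAF, hxA⟩ := mem_avoiding.1 hA
  have hcard := card_petals hS ((hSF A hA).trans (mem_powersetCard.1 (hF.1 hAF)).1) hx
    fun h => hxA (hSF A hA h)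
  have hSne : S.Nonempty := card_pos.1 (by omega)
  have hunion := hF.union_petals (x := x) hSne fun B hB =>
    hF.not_disjoint_of_le_card_avoiding hS hSF hSne (by omega) hB
  have havoid := hF.avoiding_union_petals hSF
  obtain ⟨E, hE, hFE⟩ := hunion.exists_isCopyOfE (x := x) (by rw [havoid, hcard]) fun _ => by
    rw [havoid]
    exact card_commonIntersection (fun B hB => (mem_petals.1 hB).1) hSk
      (fun B hB => (mem_petals.1 hB).2.1) (by omega)
  exact ⟨n - k, Or.inr rfl, x, hx, E, hE, subset_union_left.trans hFE⟩

end NearStar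

end LargeIntersecting

theorem mainTheorem8 (n k : ℕ) (hk : 10 ≤ 2 * k) (hn : 2 * k < n)
    (F : Finset (Finset ℕ)) (hF : LargeIntersecting.IsIntersectingFamily n k F)
    (hcard : (LargeIntersecting.familyJ n k 3).card < F.card) :
    ∃ l : ℕ, (l ≤ k - 1 ∨ l = n - k) ∧
      ∃ x ∈ LargeIntersecting.ground n, ∃ E : Finset (Finset ℕ),
        LargeIntersecting.IsCopyOfE n k l x E ∧ F ⊆ E := by
  obtain ⟨m, rfl⟩ : ∃ m, n = m + k + 1 := ⟨n - k - 1, by omega⟩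
  have hstar : LargeIntersecting.IsNearStar (m + k + 1) k F := by
    by_contra hFstar
    exact hcard.not_ge (hF.card_le_card_familyJ (by omega) (by omega) hFstar)
  exact hstar.exists_isCopyOfE hF (by omega)
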